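/- Let $M$ be a smooth (Hausdorff, second countable, finite-dimensional, boundaryless) manifold and let $\Omega(M)=\bigoplus_k\Omega^k(M)$ be its exterior algebra of smooth differential forms, with product the wedge product. A \emph{metric} on $M$ is a smooth nondegenerate symmetric $(0,2)$-tensor field $g$ (of any signature); write $(\ ,\ )_g$ for the inverse metric on $1$-forms. A \emph{BV algebra structure} on $\Omega(M)$ is an $\mathbb R$-linear map $\delta:\Omega(M)\to\Omega(M)$ that lowers degree by $1$ (and vanishes on $\Omega^0(M)=C^\infty(M)$), with $\delta^2=0$, obeying the 7-term identity \[ \delta(\omega\eta\zeta)=(\delta(\omega\eta))\zeta+(-1)^{|\omega|}\omega\,\delta(\eta\zeta)+(-1)^{(|\omega|-1)|\eta|}\eta\,\delta(\omega\zeta)-(\delta\omega)\eta\zeta-(-1)^{|\omega|}\omega(\delta\eta)\zeta-(-1)^{|\omega|+|\eta|}\omega\eta\,\delta\zeta \] for all homogeneous $\omega,\eta$ and all $\zeta$ in $\Omega(M)$. It is \emph{symmetric} if $\delta(a\,{\rm d}b)-a\,\delta{\rm d}b=\delta(b\,{\rm d}a)-b\,\delta{\rm d}a$ for all $a,b\in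 C^\infty(M)$. Its \emph{associated bilinear form} on $1$-forms is given by $(\omega,{\rm d}a)=\delta(a\omega)-a\,\delta\omega$ for $a\in C^\infty(M)$, $\omega\in\Omega^1(M)$; it is \emph{nondegenerate} if for every $x\in M$ and $\omega\in\Omega^1(M)$, $(\omega,{\rm d}a)(x)=0$ for all $a$ implies $\omega_x=0$, and \emph{positive definite} if $({\rm d}a,{\rm d}a)(x)>0$ whenever ${\rm d}a_x\ne0$. Then $M$ admits a metric if and only if $\Omega(M)$ admits a symmetric BV algebra structure with nondegenerate associated bilinear form; and $M$ admits a positive definite metric if and only if it admits such a structure with positive definite associated bilinear form. More precisely: (a) For every symmetric BV algebra structure $\delta$ with nondegenerate associated bilinear form there is a unique metric $g$ on $M$ with $\delta(a\omega)-a\,\delta\omega=(\omega,{\rm d}a)_g$ for all $a\in C^\infty(M)$, $\omega\in\Omega^1(M)$; this $g$ is positive definite if and only if the associated bilinear form is. (b) For every metric $g$ on $M$ there is a unique linear map $\delta$ on $\Omega(M)$ that is the codifferential (divergence) of $g$, i.e. is given in every smooth chart by $\delta\omega=\sum_{i,j}g^{ij}\,\iota_{\partial_i}\nabla_{\partial_j}\omega$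 with $\nabla$ the Levi-Civita connection of $g$ (so that $\delta\omega=\operatorname{div}(\omega^\sharp)$ on $1$-forms). This $\delta$ is a symmetric BV algebra structure, in particular obeys the 7-term identity, its associated bilinear form is nondegenerate, and $\delta(a\omega)-a\,\delta\omega=(\omega,{\rm d}a)_g$ for all $a\in C^\infty(M)$, $\omega\in\Omega^1(M)$. -/

import Mathlib

open scoped Manifold ContDiff

noncomputable section

namespace BVGeom

/-! ### Coordinate forms on `ℝⁿ` -/

/-- The coordinate space `ℝⁿ`. -/
abbrev Coord (n : ℕ) : Type := EuclideanSpace ℝ (Fin n)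

/-- The exterior algebra `Λ((ℝⁿ)*)`. -/
abbrev CoordAlg (n : ℕ) : Type := ExteriorAlgebra ℝ (Module.Dual ℝ (Coord n))

/-- The standard basis `∂₁, …, ∂ₙ` of `ℝⁿ`. -/
def frame (n : ℕ) : Module.Basis (Fin n) ℝ (Coord n) :=
  (EuclideanSpace.basisFun (Fin n) ℝ).toBasis

/-- The dual basis `dx¹, …, dxⁿ` of `(ℝⁿ)*`. -/
def coframe (n : ℕ) : Module.Basis (Fin n) ℝ (Module.Dual ℝ (Coord n)) :=
  (frame n).dualBasis

/-- The basis `dx^S = dx^{s₁} ∧ ⋯ ∧ dx^{sₖ}` of `Λ((ℝⁿ)*)`, for `S = {s₁ < ⋯ < sₖ}`. -/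
def formBasis (n : ℕ) : Module.Basis (Finset (Fin n)) ℝ (CoordAlg n) :=
  (coframe n).ExteriorAlgebra

/-- The partial derivative `∂ᵢ f` of a real function on `ℝⁿ`. -/
def pderiv {n : ℕ} (i : Fin n) (f : Coord n → ℝ) (u : Coord n) : ℝ :=
  fderiv ℝ f u (frame n i)

/-- The partial derivative `∂ᵢ θ = ∑_S (∂ᵢ θ_S) dx^S` of a form `θ = ∑_S θ_S dx^S` on `ℝⁿ`. -/
def formPDeriv {n : ℕ} (i : Fin n) (θ : Coord n → CoordAlg n) (u : Coord n) : CoordAlg n :=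
  ∑ S : Finset (Fin n), pderiv i (fun v => (formBasis n).repr (θ v) S) u • formBasis n S

/-- The interior product `ι_{∂ᵢ}` on `Λ((ℝⁿ)*)`. -/
def intProd {n : ℕ} (i : Fin n) : CoordAlg n →ₗ[ℝ] CoordAlg n :=
  CliffordAlgebra.contractLeft (Module.Dual.eval ℝ (Coord n) (frame n i))

/-- The Christoffel symbol
`Γˡⱼₘ = ½ ∑ᵣ gˡʳ (∂ⱼ gᵣₘ + ∂ₘ gᵣⱼ - ∂ᵣ gⱼₘ)` of a matrix-valued function `g` on `ℝⁿ`. -/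
def christoffel {n : ℕ} (g : Coord n → Matrix (Fin n) (Fin n) ℝ) (l j m : Fin n)
    (u : Coord n) : ℝ :=
  (1 / 2) * ∑ r, (g u)⁻¹ l r *
    (pderiv j (fun v => g v r m) u + pderiv m (fun v => g v r j) u
      - pderiv r (fun v => g v j m) u)

/-- The Levi-Civita covariant derivative of forms along `∂ⱼ`, in coordinates:
`∇ⱼ θ = ∂ⱼ θ - ∑ Γˡⱼₘ dxᵐ ∧ ι_{∂ₗ} θ`. It is the derivation of the exterior algebra with
`∇ⱼ f = ∂ⱼ f` on functions and `∇ⱼ dxˡ = - ∑ Γˡⱼₘ dxᵐ`. -/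
def coordNabla {n : ℕ} (g : Coord n → Matrix (Fin n) (Fin n) ℝ) (j : Fin n)
    (θ : Coord n → CoordAlg n) (u : Coord n) : CoordAlg n :=
  formPDeriv j θ u - ∑ l, ∑ m, christoffel g l j m u •
    (ExteriorAlgebra.ι ℝ (coframe n m) * intProd l (θ u))

/-- The divergence (codifferential) in coordinates: the metric contraction
`∑ gⁱʲ ι_{∂ᵢ} ∇ⱼ θ` of the Levi-Civita covariant derivative. -/
def coordDiv {n : ℕ} (g : Coord n → Matrix (Fin n) (Fin n) ℝ)
    (θ : Coord n → CoordAlg n) (u : Coord n) : CoordAlg n :=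
  ∑ i, ∑ j, (g u)⁻¹ i j • intProd i (coordNabla g j θ u)

/-! ### The exterior algebra of a manifold -/

variable (n : ℕ) (M : Type*) [TopologicalSpace M] [ChartedSpace (EuclideanSpace ℝ (Fin n)) M]

/-- The cotangent space `T*ₓM`. -/
abbrev Cotangent (x : M) : Type := Module.Dual ℝ (TangentSpace (𝓡 n) x)

/-- Not necessarily smooth sections of the bundle `Λ T*M`, an algebra under the pointwise
wedge product. -/
abbrev RoughForm : Type _ := ∀ x : M, ExteriorAlgebra ℝ (Cotangent n M x)

variable {n M}

/-- The coordinate expression of a form in a chart `φ`: its pullback under `φ⁻¹`. -/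
def localForm (φ : OpenPartialHomeomorph M (EuclideanSpace ℝ (Fin n))) (θ : RoughForm n M)
    (u : Coord n) : CoordAlg n :=
  ExteriorAlgebra.map
    (Module.Dual.transpose (R := ℝ) (M := Coord n) (M' := TangentSpace (𝓡 n) (φ.symm u))
      (mfderiv (𝓡 n) (𝓡 n) φ.symm u).toLinearMap)
    (θ (φ.symm u))

/-- A form is smooth if its coefficients in every smooth chart are smooth. -/
def IsSmoothForm (θ : RoughForm n M) : Prop :=
  ∀ φ ∈ IsManifold.maximalAtlas (𝓡 n) ∞ M, ∀ S : Finset (Fin n),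
    ContDiffOn ℝ ∞ (fun u => (formBasis n).repr (localForm φ θ u) S) φ.target

/-- The coefficients of a product are bilinear in the coefficients of the factors. -/
theorem repr_mul (a b : CoordAlg n) (S : Finset (Fin n)) :
    (formBasis n).repr (a * b) S = ∑ A : Finset (Fin n), ∑ B : Finset (Fin n),
      (formBasis n).repr a A * (formBasis n).repr b B *
        (formBasis n).repr (formBasis n A * formBasis n B) S := by
  have h : a * b = ∑ A : Finset (Fin n), ∑ B : Finset (Fin n),
      ((formBasis n).repr a A * (formBasis n).repr b B) • (formBasis n A * formBasis n B) := by
    rw [← (formBasis n).sum_repr a, ← (formBasis n).sum_repr b, Finset.sum_mul_sum]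
    simp only [smul_mul_smul_comm, (formBasis n).sum_repr]
  rw [h]
  simp only [map_sum, Finsupp.finsetSum_apply, map_smul, Finsupp.smul_apply, smul_eq_mul]

variable (n M) in
/-- The exterior algebra `Ω(M)` of smooth differential forms (of mixed degree). -/
def Forms : Subalgebra ℝ (RoughForm n M) where
  carrier := {θ | IsSmoothForm θ}
  mul_mem' := by
    intro a b ha hb φ hφ S
    have : (fun u => (formBasis n).repr (localForm φ (a * b) u) S) =
        fun u => ∑ A : Finset (Fin n), ∑ B : Finset (Fin n),
          (formBasis n).repr (localForm φ a u) A * (formBasis n).repr (localForm φ b u) B *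
            (formBasis n).repr (formBasis n A * formBasis n B) S := by
      funext u
      rw [← repr_mul]
      simp [localForm]
    rw [this]
    refine ContDiffOn.sum fun A _ => ContDiffOn.sum fun B _ => ?_
    exact ((ha φ hφ A).mul (hb φ hφ B)).mul contDiffOn_const
  add_mem' := by
    intro a b ha hb φ hφ S
    simpa [localForm] using (ha φ hφ S).add (hb φ hφ S)
  algebraMap_mem' := by
    intro r φ _ S
    simpa [localForm] using contDiffOn_const

variable (n M) in
/-- The space `Ωᵏ(M)` of forms that are homogeneous of degree `k`. -/
def formsOfDegree (k : ℕ) : Submodule ℝ (Forms n M) where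
  carrier := {θ | ∀ x, (θ : RoughForm n M) x ∈ ⋀[ℝ]^k (Cotangent n M x)}
  add_mem' ha hb x := Submodule.add_mem _ (ha x) (hb x)
  zero_mem' _ := Submodule.zero_mem _
  smul_mem' c _ ha x := Submodule.smul_mem _ c (ha x)

/-- The differential of a function at a point, as a covector. -/
def dAt (a : C^∞⟮𝓡 n, M; ℝ⟯) (x : M) : Cotangent n M x :=
  (mfderiv (𝓡 n) 𝓘(ℝ, ℝ) a x).toLinearMap

/-- A smooth function as a differential form of degree `0`. -/
def ofFun (a : C^∞⟮𝓡 n, M; ℝ⟯) : Forms n M :=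
  ⟨fun x => algebraMap ℝ _ (a x), by
    intro φ hφ S
    have h : ContDiffOn ℝ ∞ (fun u => a (φ.symm u)) φ.target :=
      contMDiffOn_iff_contDiffOn.mp
        (a.contMDiff.comp_contMDiffOn (contMDiffOn_symm_of_mem_maximalAtlas hφ))
    have e : (fun u => (formBasis n).repr
        (localForm φ (fun x => algebraMap ℝ _ (a x)) u) S) =
        fun u => a (φ.symm u) * (formBasis n).repr 1 S := by
      funext u
      simp [localForm, Algebra.algebraMap_eq_smul_one]
    rw [e]
    exact h.mul contDiffOn_const⟩

/-- The exterior differential `da ∈ Ω¹(M)` of a smooth function. -/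
def dFun (a : C^∞⟮𝓡 n, M; ℝ⟯) : Forms n M :=
  ⟨fun x => ExteriorAlgebra.ι ℝ (dAt a x), by
    intro φ hφ S
    have h : ContDiffOn ℝ ∞ (fun u => a (φ.symm u)) φ.target :=
      contMDiffOn_iff_contDiffOn.mp
        (a.contMDiff.comp_contMDiffOn (contMDiffOn_symm_of_mem_maximalAtlas hφ))
    have h' : ContDiffOn ℝ ∞ (fderiv ℝ (fun u => a (φ.symm u))) φ.target :=
      h.fderiv_of_isOpen φ.open_target (by simp)
    let L : (Coord n →L[ℝ] ℝ) →ₗ[ℝ] ℝ :=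
      (Finsupp.lapply S ∘ₗ (formBasis n).repr.toLinearMap ∘ₗ ExteriorAlgebra.ι ℝ) ∘ₗ
        ContinuousLinearMap.coeLM ℝ
    refine ((LinearMap.toContinuousLinearMap L).contDiff.comp_contDiffOn h').congr ?_
    intro u hu
    have h1 : MDifferentiableAt (𝓡 n) 𝓘(ℝ, ℝ) a (φ.symm u) :=
      a.contMDiff.mdifferentiable (by simp) _
    have h2 : MDifferentiableAt (𝓡 n) (𝓡 n) φ.symm u :=
      (contMDiffAt_symm_of_mem_maximalAtlas hφ hu).mdifferentiableAt (by simp)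
    have h3 : fderiv ℝ (fun u => a (φ.symm u)) u =
        (mfderiv (𝓡 n) 𝓘(ℝ, ℝ) a (φ.symm u)).comp (mfderiv (𝓡 n) (𝓡 n) φ.symm u) := by
      rw [← mfderiv_eq_fderiv]
      exact mfderiv_comp u h1 h2
    show (formBasis n).repr (localForm φ _ u) S = (formBasis n).repr (ExteriorAlgebra.ι ℝ
      (fderiv ℝ (fun u => a (φ.symm u)) u).toLinearMap) S
    rw [h3, localForm, ExteriorAlgebra.map_apply_ι]
    rfl⟩

/-! ### Batalin-Vilkovisky structures on `Ω(M)` -/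

/-- `δ` makes the graded-commutative algebra `Ω(M)` a BV algebra: it lowers degree by one, squares
to zero and obeys the 7-term identity. The sign `(-1)^((p+1)q)` is `(-1)^((p-1)q)`. -/
structure IsBV (δ : Forms n M →ₗ[ℝ] Forms n M) : Prop where
  degree_zero : ∀ θ ∈ formsOfDegree n M 0, δ θ = 0
  degree_succ : ∀ k, ∀ θ ∈ formsOfDegree n M (k + 1), δ θ ∈ formsOfDegree n M k
  sq_zero : ∀ θ, δ (δ θ) = 0
  seven_term : ∀ p q, ∀ θ ∈ formsOfDegree n M p, ∀ η ∈ formsOfDegree n M q, ∀ ζ : Forms n M,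
    δ (θ * η * ζ) =
      δ (θ * η) * ζ + (-1) ^ p * (θ * δ (η * ζ)) + (-1) ^ ((p + 1) * q) * (η * δ (θ * ζ))
        - δ θ * η * ζ - (-1) ^ p * (θ * δ η * ζ) - (-1) ^ (p + q) * (θ * η * δ ζ)

/-- The symmetry condition `δ(a db) - a δ(db) = δ(b da) - b δ(da)`. -/
def IsSymmetricOp (δ : Forms n M →ₗ[ℝ] Forms n M) : Prop :=
  ∀ a b : C^∞⟮𝓡 n, M; ℝ⟯,
    δ (ofFun a * dFun b) - ofFun a * δ (dFun b) = δ (ofFun b * dFun a) - ofFun b * δ (dFun a)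

/-- The associated bilinear form `(θ, da) = δ(a θ) - a δθ` on `1`-forms, at the point `x`.
The right-hand side is a form of degree `0` if `δ` lowers degree by one and `θ ∈ Ω¹(M)`;
`algebraMapInv` reads it as a number. -/
def pairing (δ : Forms n M →ₗ[ℝ] Forms n M) (θ : Forms n M) (a : C^∞⟮𝓡 n, M; ℝ⟯) (x : M) : ℝ :=
  ExteriorAlgebra.algebraMapInv
    (((δ (ofFun a * θ) - ofFun a * δ θ : Forms n M) : RoughForm n M) x)

/-- The associated bilinear form is nondegenerate at every point. -/
def PairingNondegenerate (δ : Forms n M →ₗ[ℝ] Forms n M) : Prop :=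
  ∀ x : M, ∀ θ ∈ formsOfDegree n M 1,
    (∀ a : C^∞⟮𝓡 n, M; ℝ⟯, pairing δ θ a x = 0) → (θ : RoughForm n M) x = 0

/-- The associated bilinear form is positive definite at every point. -/
def PairingPosDef (δ : Forms n M →ₗ[ℝ] Forms n M) : Prop :=
  ∀ (x : M) (a : C^∞⟮𝓡 n, M; ℝ⟯), dAt a x ≠ 0 → 0 < pairing δ (dFun a) a x

/-! ### Metrics -/

variable (n M) in
/-- A metric on `M` (of any signature): a smooth field of nondegenerate symmetric bilinear forms
on the tangent spaces. Smoothness: the components `gᵢⱼ = g(∂ᵢ, ∂ⱼ)` in every smooth chart are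
smooth. -/
@[ext]
structure Metric where
  val : ∀ x : M, LinearMap.BilinForm ℝ (TangentSpace (𝓡 n) x)
  symm : ∀ x v w, val x v w = val x w v
  nondegenerate : ∀ x, (val x).Nondegenerate
  smooth : ∀ φ ∈ IsManifold.maximalAtlas (𝓡 n) ∞ M, ∀ i j : Fin n,
    ContDiffOn ℝ ∞ (fun u : Coord n => val (φ.symm u)
      (mfderiv (𝓡 n) (𝓡 n) φ.symm u (frame n i))
      (mfderiv (𝓡 n) (𝓡 n) φ.symm u (frame n j))) φ.target

namespace Metric

/-- The metric is positive definite. -/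
def PosDef (g : Metric n M) : Prop := ∀ x v, v ≠ 0 → 0 < g.val x v v

/-- The component matrix `gᵢⱼ` in a chart. -/
def components (g : Metric n M) (φ : OpenPartialHomeomorph M (EuclideanSpace ℝ (Fin n)))
    (u : Coord n) : Matrix (Fin n) (Fin n) ℝ :=
  Matrix.of fun i j => g.val (φ.symm u)
    (mfderiv (𝓡 n) (𝓡 n) φ.symm u (frame n i))
    (mfderiv (𝓡 n) (𝓡 n) φ.symm u (frame n j))

instance (x : M) : FiniteDimensional ℝ (TangentSpace (𝓡 n) x) :=
  inferInstanceAs (FiniteDimensional ℝ (EuclideanSpace ℝ (Fin n)))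

/-- The inverse metric on covectors: `(α, β) = g(α♯, β♯)`, where `g(α♯, ·) = α`. -/
def inv (g : Metric n M) (x : M) (α β : Cotangent n M x) : ℝ :=
  g.val x (((g.val x).toDual (g.nondegenerate x)).symm α)
    (((g.val x).toDual (g.nondegenerate x)).symm β)

end Metric

/-- The bilinear form associated to `δ` is the inverse of the metric `g`:
`δ(a θ) - a δθ = (θ, da)` for all `1`-forms `θ` and functions `a`. -/
def IsInverseMetricOf (δ : Forms n M →ₗ[ℝ] Forms n M) (g : Metric n M) : Prop :=
  ∀ θ ∈ formsOfDegree n M 1, ∀ (a : C^∞⟮𝓡 n, M; ℝ⟯) (x : M),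
    pairing δ θ a x = g.inv x (ExteriorAlgebra.ιInv ((θ : RoughForm n M) x)) (dAt a x)

/-- `δ` is the codifferential (divergence) of `g`: in every smooth chart it is the metric
contraction of the Levi-Civita covariant derivative. On `1`-forms this is
`δθ = div(θ♯)`. With this sign `δ` is minus the formal adjoint of `d`. -/
def IsCodifferential (g : Metric n M) (δ : Forms n M →ₗ[ℝ] Forms n M) : Prop :=
  ∀ φ ∈ IsManifold.maximalAtlas (𝓡 n) ∞ M, ∀ (θ : Forms n M), ∀ u ∈ φ.target,
    localForm φ (δ θ : RoughForm n M) u =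
      coordDiv (g.components φ) (localForm φ (θ : RoughForm n M)) u

end BVGeom
end

/-!
Write `(ω, da) = δ(aω) - a δω`. The 7-term identity with two arguments of degree `0` makes this
`C^∞`-linear in `ω`; symmetry then makes it tensorial in both arguments, and nondegeneracy lets one
invert that tensor to a metric.

Conversely, each term `g^{ij} ι_{∂_i} ∇_{∂_j}` of the codifferential composes a contraction, which
is an odd derivation, with a covariant derivative, which is an even one, and such composites obey
the 7-term identity. Raising indices turns `δ` into the divergence `∑_j ι_{dx^j} (∂_j + w_j)` of
polyvector fields, where `w_j = ½ tr (g⁻¹ ∂_j g)` is the logarithmic derivative of the volume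
density. The operators `∂_j + w_j` commute while contractions anticommute, so `δ² = 0`. The local
formulas agree on overlaps because the Christoffel symbols are determined by metric compatibility
and torsion-freeness.
-/

noncomputable section

namespace BVGeom

/-! ### Contractions and derivations of an exterior algebra -/

section ExteriorAlgebra

open CliffordAlgebra (involute contractLeft)
open ExteriorAlgebra (ι algebraMapInv)

variable {R V W : Type*} [CommRing R] [AddCommGroup V] [Module R V] [AddCommGroup W] [Module R W]

theorem involute_ι (v : V) : involute (ι R v) = -ι R v :=
  CliffordAlgebra.involute_ι (Q := 0) v

theorem contractLeft_algebraMap (d : Module.Dual R V) (r : R) :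
    contractLeft d (algebraMap R (ExteriorAlgebra R V) r) = 0 :=
  CliffordAlgebra.contractLeft_algebraMap (Q := 0) d r

theorem contractLeft_ι (d : Module.Dual R V) (v : V) :
    contractLeft d (ι R v) = algebraMap R (ExteriorAlgebra R V) (d v) :=
  CliffordAlgebra.contractLeft_ι (Q := 0) d v

theorem contractLeft_ι_mul (d : Module.Dual R V) (v : V) (a : ExteriorAlgebra R V) :
    contractLeft d (ι R v * a) = d v • a - ι R v * contractLeft d a :=
  CliffordAlgebra.contractLeft_ι_mul (Q := 0) d v a

theorem mul_mem_exteriorPower {p q : ℕ} {a b : ExteriorAlgebra R V} (ha : a ∈ ⋀[R]^p V)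
    (hb : b ∈ ⋀[R]^q V) : a * b ∈ ⋀[R]^(p + q) V :=
  SetLike.mul_mem_graded (A := fun i : ℕ => ⋀[R]^i V) ha hb

theorem ι_mem_exteriorPower (v : V) : ι R v ∈ ⋀[R]^1 V := by
  simp

theorem algebraMap_mem_exteriorPower (r : R) :
    algebraMap R (ExteriorAlgebra R V) r ∈ ⋀[R]^0 V :=
  SetLike.algebraMap_mem_graded (fun i : ℕ => ⋀[R]^i V) r

theorem exists_algebraMap_of_mem_zero {a : ExteriorAlgebra R V} (ha : a ∈ ⋀[R]^0 V) :
    ∃ r : R, algebraMap R _ r = a := by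
  rw [ExteriorAlgebra.exteriorPower, pow_zero] at ha
  exact Submodule.mem_one.1 ha

theorem exists_ι_of_mem_one {a : ExteriorAlgebra R V} (ha : a ∈ ⋀[R]^1 V) :
    ∃ v : V, ι R v = a := by
  rwa [ExteriorAlgebra.exteriorPower, pow_one] at ha

theorem neg_one_pow_mul_comm {A : Type*} [Ring A] (k : ℕ) (a : A) :
    (-1) ^ k * a = a * (-1) ^ k :=
  ((Commute.neg_one_left a).pow_left k).eq

theorem involute_of_mem {p : ℕ} {a : ExteriorAlgebra R V} (ha : a ∈ ⋀[R]^p V) :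
    involute a = (-1) ^ p * a := by
  induction ha using Submodule.pow_induction_on_left' with
  | algebraMap r => simp
  | add x y i _ _ ihx ihy => rw [map_add, ihx, ihy, mul_add]
  | mem_mul m hm i x _ ih =>
    obtain ⟨v, rfl⟩ := hm
    rw [map_mul, ih, involute_ι, pow_succ', neg_one_mul, neg_mul, neg_mul, ← mul_assoc,
      ← neg_one_pow_mul_comm, mul_assoc]

theorem ι_mul_involute (v : V) (a : ExteriorAlgebra R V) :
    ι R v * involute a = a * ι R v := by
  induction a using ExteriorAlgebra.induction with
  | algebraMap r => rw [AlgHom.commutes, Algebra.commutes]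
  | ι w =>
    rw [involute_ι, mul_neg]
    exact neg_eq_of_add_eq_zero_right (ExteriorAlgebra.ι_add_mul_swap v w)
  | mul a b ha hb => rw [map_mul, ← mul_assoc, ha, mul_assoc, hb, mul_assoc]
  | add a b ha hb => rw [map_add, mul_add, ha, hb, add_mul]

theorem mul_comm_of_mem {p q : ℕ} {a b : ExteriorAlgebra R V} (ha : a ∈ ⋀[R]^p V)
    (hb : b ∈ ⋀[R]^q V) : b * a = (-1) ^ (p * q) * (a * b) := by
  induction ha using Submodule.pow_induction_on_left' with
  | algebraMap r => simp [(Algebra.commutes r b).symm]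
  | add x y i _ _ ihx ihy => rw [mul_add, ihx, ihy, add_mul, mul_add]
  | mem_mul m hm i x _ ih =>
    obtain ⟨v, rfl⟩ := hm
    have hv : b * ι R v = (-1) ^ q * (ι R v * b) := by
      rw [← ι_mul_involute, involute_of_mem hb, ← mul_assoc, ← neg_one_pow_mul_comm, mul_assoc]
    calc b * (ι R v * x) = (-1) ^ q * (ι R v * (b * x)) := by
          rw [← mul_assoc, hv, mul_assoc, mul_assoc]
      _ = (-1) ^ ((i + 1) * q) * (ι R v * x * b) := by
          rw [ih, ← mul_assoc (ι R v), ← neg_one_pow_mul_comm, mul_assoc ((-1) ^ (i * q)),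
            ← mul_assoc, ← pow_add, add_comm q, ← Nat.succ_mul, mul_assoc (ι R v)]

theorem contractLeft_mul (d : Module.Dual R V) (a b : ExteriorAlgebra R V) :
    contractLeft d (a * b) = contractLeft d a * b + involute a * contractLeft d b := by
  induction a using ExteriorAlgebra.induction generalizing b with
  | algebraMap r =>
    rw [contractLeft_algebraMap, AlgHom.commutes, zero_mul, zero_add]
    exact CliffordAlgebra.contractLeft_algebraMap_mul (Q := 0) d r b
  | ι v =>
    rw [contractLeft_ι_mul, contractLeft_ι, involute_ι, Algebra.smul_def, neg_mul, sub_eq_add_neg]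
  | mul a c ha hc =>
    rw [mul_assoc, ha, hc, ha c, map_mul]
    simp only [mul_add, add_mul, mul_assoc, add_assoc]
  | add a c ha hc => simp only [add_mul, map_add, ha, hc, add_add_add_comm]

theorem contractLeft_of_mem_zero (d : Module.Dual R V) {a : ExteriorAlgebra R V}
    (ha : a ∈ ⋀[R]^0 V) : contractLeft d a = 0 := by
  obtain ⟨r, rfl⟩ := exists_algebraMap_of_mem_zero ha
  exact contractLeft_algebraMap d r

theorem contractLeft_mem {p : ℕ} (d : Module.Dual R V) {a : ExteriorAlgebra R V}
    (ha : a ∈ ⋀[R]^(p + 1) V) : contractLeft d a ∈ ⋀[R]^p V := by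
  suffices h : ∀ q, ∀ a ∈ ⋀[R]^q V, contractLeft d a ∈ ⋀[R]^(q - 1) V from h _ a ha
  intro q a ha
  induction ha using Submodule.pow_induction_on_left' with
  | algebraMap r => simp only [contractLeft_algebraMap, Submodule.zero_mem]
  | add x y i _ _ ihx ihy => exact map_add (contractLeft d) x y ▸ Submodule.add_mem _ ihx ihy
  | mem_mul m hm i x hx ih =>
    obtain ⟨v, rfl⟩ := hm
    rw [contractLeft_ι_mul]
    refine Submodule.sub_mem _ (Submodule.smul_mem _ _ hx) ?_
    cases i with
    | zero => rw [contractLeft_of_mem_zero d hx, mul_zero]; exact Submodule.zero_mem _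
    | succ k => exact add_comm 1 k ▸ mul_mem_exteriorPower (ι_mem_exteriorPower v) ih

theorem neg_one_pow_mul_mul_contractLeft_mul (d : Module.Dual R V) {p q : ℕ}
    {a b : ExteriorAlgebra R V} (ha : a ∈ ⋀[R]^p V) (hb : b ∈ ⋀[R]^q V)
    (c : ExteriorAlgebra R V) :
    (-1) ^ ((p + 1) * q) * (b * contractLeft d (a * c)) =
      contractLeft d a * b * c + (-1) ^ (p + q) * (a * b * contractLeft d c) := by
  have hba : b * a = (-1) ^ (p * q) * (a * b) := mul_comm_of_mem ha hb
  have hbda : b * contractLeft d a = (-1) ^ ((p + 1) * q) * (contractLeft d a * b) := by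
    cases p with
    | zero => simp [contractLeft_of_mem_zero d ha]
    | succ p =>
      rw [mul_comm_of_mem (contractLeft_mem d ha) hb,
        show (p + 1 + 1) * q = p * q + (q + q) by ring, pow_add _ (p * q),
        Even.neg_one_pow ⟨q, rfl⟩, mul_one]
  rw [contractLeft_mul, involute_of_mem ha, mul_add, ← mul_assoc b, hbda, mul_assoc _ a,
    ← mul_assoc b, ← neg_one_pow_mul_comm, mul_assoc _ b, ← mul_assoc b, hba, Nat.succ_mul,
    pow_add _ (p * q), pow_add _ p]
  rcases neg_one_pow_eq_or (ExteriorAlgebra R V) (p * q) with h | h <;>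
  rcases neg_one_pow_eq_or (ExteriorAlgebra R V) p with h' | h' <;>
  rcases neg_one_pow_eq_or (ExteriorAlgebra R V) q with h'' | h'' <;>
    rw [h, h', h''] <;> noncomm_ring

/-- Here `a'`, `b'`, `c'` stand for the values of an even derivation on `a`, `b`, `c`. -/
theorem seven_term_of_derivation (d : Module.Dual R V) {p q : ℕ} {a a' b b' : ExteriorAlgebra R V}
    (ha : a ∈ ⋀[R]^p V) (ha' : a' ∈ ⋀[R]^p V) (hb : b ∈ ⋀[R]^q V) (hb' : b' ∈ ⋀[R]^q V)
    (c c' : ExteriorAlgebra R V) :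
    contractLeft d (a' * b * c + a * b' * c + a * b * c') =
      contractLeft d (a' * b + a * b') * c + (-1) ^ p * (a * contractLeft d (b' * c + b * c'))
        + (-1) ^ ((p + 1) * q) * (b * contractLeft d (a' * c + a * c'))
        - contractLeft d a' * b * c - (-1) ^ p * (a * contractLeft d b' * c)
        - (-1) ^ (p + q) * (a * b * contractLeft d c') := by
  rw [map_add (contractLeft d) (a' * c), mul_add b, mul_add ((-1) ^ ((p + 1) * q)),
    neg_one_pow_mul_mul_contractLeft_mul d ha' hb c,
    neg_one_pow_mul_mul_contractLeft_mul d ha hb c']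
  simp only [map_add, contractLeft_mul, map_mul, involute_of_mem ha, involute_of_mem ha',
    involute_of_mem hb, involute_of_mem hb', pow_add]
  rcases neg_one_pow_eq_or (ExteriorAlgebra R V) p with hp | hp <;>
  rcases neg_one_pow_eq_or (ExteriorAlgebra R V) q with hq | hq <;>
    rw [hp, hq] <;> noncomm_ring

theorem map_mem_exteriorPower (f : V →ₗ[R] W) {p : ℕ} {a : ExteriorAlgebra R V}
    (ha : a ∈ ⋀[R]^p V) : ExteriorAlgebra.map f a ∈ ⋀[R]^p W := by
  have h := Submodule.mem_map_of_mem (f := (ExteriorAlgebra.map f).toLinearMap) ha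
  rw [Submodule.map_pow, ← LinearMap.range_comp] at h
  refine pow_le_pow_left' (M := Submodule R (ExteriorAlgebra R W)) ?_ p h
  rintro _ ⟨v, rfl⟩
  exact ⟨f v, (ExteriorAlgebra.map_apply_ι f v).symm⟩

theorem involute_map (f : V →ₗ[R] W) (a : ExteriorAlgebra R V) :
    involute (ExteriorAlgebra.map f a) = ExteriorAlgebra.map f (involute a) := by
  induction a using ExteriorAlgebra.induction with
  | algebraMap r => simp only [AlgHom.commutes]
  | ι v => rw [ExteriorAlgebra.map_apply_ι, involute_ι, involute_ι, map_neg,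
      ExteriorAlgebra.map_apply_ι]
  | mul a b ha hb => simp only [map_mul, ha, hb]
  | add a b ha hb => simp only [map_add, ha, hb]

theorem contractLeft_map (f : V →ₗ[R] W) (d : Module.Dual R W) (a : ExteriorAlgebra R V) :
    contractLeft d (ExteriorAlgebra.map f a) = ExteriorAlgebra.map f (contractLeft (d ∘ₗ f) a) := by
  induction a using ExteriorAlgebra.induction with
  | algebraMap r => rw [AlgHom.commutes, contractLeft_algebraMap, contractLeft_algebraMap, map_zero]
  | ι v => rw [ExteriorAlgebra.map_apply_ι, contractLeft_ι, contractLeft_ι, AlgHom.commutes,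
      LinearMap.comp_apply]
  | mul a b ha hb => simp only [map_mul, contractLeft_mul, ha, hb, map_add, involute_map]
  | add a b ha hb => simp only [map_add, ha, hb]

theorem algebraMapInv_map (f : V →ₗ[R] W) (a : ExteriorAlgebra R V) :
    algebraMapInv (ExteriorAlgebra.map f a) = algebraMapInv a := by
  suffices h : algebraMapInv.comp (ExteriorAlgebra.map f) = algebraMapInv from
    DFunLike.congr_fun h a
  ext v
  simp [algebraMapInv]

theorem map_transpose_map_transpose {U : Type*} [AddCommGroup U] [Module R U] (f : U →ₗ[R] V)
    (g : V →ₗ[R] W) (a : ExteriorAlgebra R (Module.Dual R W)) :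
    ExteriorAlgebra.map (Module.Dual.transpose f)
        (ExteriorAlgebra.map (Module.Dual.transpose g) a) =
      ExteriorAlgebra.map (Module.Dual.transpose (g ∘ₗ f)) a := by
  rw [← AlgHom.comp_apply, ExteriorAlgebra.map_comp_map, Module.Dual.transpose_comp]

theorem map_transpose_map_transpose_of_comp_eq_id {f : V →ₗ[R] W} {g : W →ₗ[R] V}
    (h : g ∘ₗ f = LinearMap.id) (a : ExteriorAlgebra R (Module.Dual R V)) :
    ExteriorAlgebra.map (Module.Dual.transpose f)
      (ExteriorAlgebra.map (Module.Dual.transpose g) a) = a := by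
  have hid : Module.Dual.transpose (LinearMap.id : V →ₗ[R] V) = LinearMap.id := rfl
  rw [map_transpose_map_transpose, h, hid, ExteriorAlgebra.map_id, AlgHom.id_apply]

variable {κ : Type*} [Fintype κ] (b : Module.Basis κ R V)

/-- The even derivation of the exterior algebra that extends the endomorphism `N` of `V`,
namely `∑ₗ N bₗ ∧ ι_{bˡ}` for any basis `b` of `V`. -/
def derivExt : Module.End R V →ₗ[R] Module.End R (ExteriorAlgebra R V) where
  toFun N := ∑ l, LinearMap.mulLeft R (ι R (N (b l))) ∘ₗ contractLeft (b.coord l)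
  map_add' N N' := LinearMap.ext fun a => by simp [add_mul, Finset.sum_add_distrib]
  map_smul' r N := LinearMap.ext fun a => by simp [Finset.smul_sum]

theorem derivExt_apply (N : Module.End R V) (a : ExteriorAlgebra R V) :
    derivExt b N a = ∑ l, ι R (N (b l)) * contractLeft (b.coord l) a := by
  simp [derivExt]

theorem derivExt_algebraMap (N : Module.End R V) (r : R) :
    derivExt b N (algebraMap R _ r) = 0 := by
  simp only [derivExt_apply, contractLeft_algebraMap, mul_zero, Finset.sum_const_zero]

theorem derivExt_ι (N : Module.End R V) (v : V) : derivExt b N (ι R v) = ι R (N v) := by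
  conv_rhs => rw [← b.sum_repr v, map_sum, map_sum]
  refine (derivExt_apply b N _).trans (Finset.sum_congr rfl fun l _ => ?_)
  rw [contractLeft_ι, ← Algebra.commutes, ← Algebra.smul_def, map_smul, map_smul, b.coord_apply]

theorem derivExt_mul (N : Module.End R V) (a c : ExteriorAlgebra R V) :
    derivExt b N (a * c) = derivExt b N a * c + a * derivExt b N c := by
  simp only [derivExt_apply, contractLeft_mul, mul_add, Finset.sum_add_distrib, Finset.sum_mul,
    Finset.mul_sum, ← mul_assoc, ι_mul_involute]

theorem derivExt_mem (N : Module.End R V) {p : ℕ} {a : ExteriorAlgebra R V} (ha : a ∈ ⋀[R]^p V) :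
    derivExt b N a ∈ ⋀[R]^p V := by
  rw [derivExt_apply]
  refine Submodule.sum_mem _ fun l _ => ?_
  cases p with
  | zero => rw [contractLeft_of_mem_zero _ ha, mul_zero]; exact Submodule.zero_mem _
  | succ p =>
    exact add_comm 1 p ▸ mul_mem_exteriorPower (ι_mem_exteriorPower _) (contractLeft_mem _ ha)

end ExteriorAlgebra

/-! ### Calculus of coordinate forms and of matrix functions -/

/-- The sup norm of the coefficients in the basis `dx^S`. It serves to differentiate coordinate
forms; as all norms on a finite-dimensional space are equivalent, the choice does not matter. -/
@[reducible]
def coordAlgNormedAddCommGroup (n : ℕ) : NormedAddCommGroup (CoordAlg n) :=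
  NormedAddCommGroup.induced (CoordAlg n) (Finset (Fin n) → ℝ) (formBasis n).equivFun
    (formBasis n).equivFun.injective

attribute [local instance] coordAlgNormedAddCommGroup

/-- The normed space structure of the sup norm of the coefficients. -/
@[reducible]
def coordAlgNormedSpace (n : ℕ) : NormedSpace ℝ (CoordAlg n) :=
  NormedSpace.induced ℝ (CoordAlg n) (Finset (Fin n) → ℝ) (formBasis n).equivFun

attribute [local instance] coordAlgNormedSpace
attribute [local instance] Matrix.linftyOpNormedRing Matrix.linftyOpNormedAlgebra

instance (n : ℕ) : FiniteDimensional ℝ (CoordAlg n) := (formBasis n).finiteDimensional_of_finite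

section Calculus

variable {E E' F : Type*} [NormedAddCommGroup E] [NormedSpace ℝ E] [FiniteDimensional ℝ E]
  [NormedAddCommGroup E'] [NormedSpace ℝ E'] [NormedAddCommGroup F] [NormedSpace ℝ F]

theorem differentiableAt_linearMap_comp (L : E →ₗ[ℝ] E') {f : F → E} {u : F}
    (hf : DifferentiableAt ℝ f u) : DifferentiableAt ℝ (fun v => L (f v)) u :=
  L.toContinuousLinearMap.differentiableAt.comp u hf

theorem fderiv_linearMap_comp (L : E →ₗ[ℝ] E') {f : F → E} {u : F} (hf : DifferentiableAt ℝ f u)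
    (X : F) : fderiv ℝ (fun v => L (f v)) u X = L (fderiv ℝ f u X) :=
  DFunLike.congr_fun (L.toContinuousLinearMap.hasFDerivAt.comp u hf.hasFDerivAt).fderiv X

theorem contDiffAt_linearMap_comp {k : WithTop ℕ∞} (L : E →ₗ[ℝ] E') {f : F → E} {u : F}
    (hf : ContDiffAt ℝ k f u) : ContDiffAt ℝ k (fun v => L (f v)) u :=
  L.toContinuousLinearMap.contDiff.contDiffAt.comp u hf

theorem fderiv_mem_submodule {f : F → E} {u : F} (p : Submodule ℝ E)
    (h : ∀ᶠ v in nhds u, f v ∈ p) (X : F) : fderiv ℝ f u X ∈ p := by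
  by_cases hf : DifferentiableAt ℝ f u
  · refine (Subspace.forall_mem_dualAnnihilator_apply_eq_zero_iff p _).1 fun φ hφ => ?_
    have hzero : (fun v => φ (f v)) =ᶠ[nhds u] fun _ => 0 := by
      filter_upwards [h] with v hv using (Submodule.mem_dualAnnihilator φ).1 hφ _ hv
    rw [← fderiv_linearMap_comp φ hf, hzero.fderiv_eq, fderiv_const_apply,
      zero_apply]
  · rw [fderiv_zero_of_not_differentiableAt hf]
    exact p.zero_mem

variable {n : ℕ}

/-- The coefficients in the basis `dx^S`, as a continuous linear equivalence. -/
def coeffEquiv (n : ℕ) : CoordAlg n ≃L[ℝ] (Finset (Fin n) → ℝ) :=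
  (formBasis n).equivFun.toContinuousLinearEquiv

theorem contDiffAt_form_iff {k : WithTop ℕ∞} {θ : F → CoordAlg n} {u : F} :
    ContDiffAt ℝ k θ u ↔ ∀ S, ContDiffAt ℝ k (fun v => (formBasis n).repr (θ v) S) u := by
  rw [← (coeffEquiv n).comp_contDiffAt_iff, contDiffAt_pi]
  rfl

theorem formPDeriv_eq {θ : Coord n → CoordAlg n} {u : Coord n} (hθ : DifferentiableAt ℝ θ u)
    (i : Fin n) : formPDeriv i θ u = fderiv ℝ θ u (frame n i) := by
  rw [← (formBasis n).sum_repr (fderiv ℝ θ u (frame n i))]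
  exact Finset.sum_congr rfl fun S _ =>
    congrArg (· • formBasis n S) (fderiv_linearMap_comp ((formBasis n).coord S) hθ _)

/-- The wedge product as a continuous bilinear map. -/
def wedgeL (n : ℕ) : CoordAlg n →L[ℝ] CoordAlg n →L[ℝ] CoordAlg n :=
  (LinearMap.mul ℝ (CoordAlg n)).toContinuousBilinearMap

theorem differentiableAt_wedge {θ η : F → CoordAlg n} {u : F} (hθ : DifferentiableAt ℝ θ u)
    (hη : DifferentiableAt ℝ η u) : DifferentiableAt ℝ (fun v => θ v * η v) u :=
  ((wedgeL n).hasFDerivAt_of_bilinear hθ.hasFDerivAt hη.hasFDerivAt).differentiableAt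

theorem fderiv_wedge {θ η : F → CoordAlg n} {u : F} (hθ : DifferentiableAt ℝ θ u)
    (hη : DifferentiableAt ℝ η u) (X : F) :
    fderiv ℝ (fun v => θ v * η v) u X = fderiv ℝ θ u X * η u + θ u * fderiv ℝ η u X := by
  have h := (wedgeL n).hasFDerivAt_of_bilinear hθ.hasFDerivAt hη.hasFDerivAt
  exact (DFunLike.congr_fun h.fderiv X).trans (add_comm _ _)

theorem contDiffAt_wedge {k : WithTop ℕ∞} {θ η : F → CoordAlg n} {u : F} (hθ : ContDiffAt ℝ k θ u)
    (hη : ContDiffAt ℝ k η u) : ContDiffAt ℝ k (fun v => θ v * η v) u :=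
  (wedgeL n).isBoundedBilinearMap.contDiff.contDiffAt.comp u (hθ.prodMk hη)

theorem contDiffAt_clm_of_forall {k : WithTop ℕ∞} {f : F → E →L[ℝ] E'} {u : F}
    (hf : ∀ e, ContDiffAt ℝ k (fun v => f v e) u) : ContDiffAt ℝ k f u := by
  have hsum : f = fun v => ∑ i, ((Module.finBasis ℝ E).coord i).toContinuousLinearMap.smulRight
      (f v (Module.finBasis ℝ E i)) := by
    funext v
    refine ContinuousLinearMap.coe_injective ((Module.finBasis ℝ E).ext fun j => ?_)
    simp [Finsupp.single_apply]
  rw [hsum]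
  exact ContDiffAt.sum fun i _ => contDiffAt_const.smulRight (hf _)

theorem contDiffAt_matrix_iff {m : Type*} [Fintype m] [DecidableEq m] {k : WithTop ℕ∞}
    {a : F → Matrix m m ℝ} {u : F} :
    ContDiffAt ℝ k a u ↔ ∀ i j, ContDiffAt ℝ k (fun v => a v i j) u := by
  refine ⟨fun ha i j => contDiffAt_linearMap_comp (Matrix.entryLinearMap ℝ ℝ i j) ha, fun ha => ?_⟩
  exact contDiffAt_linearMap_comp (Matrix.ofLinearEquiv ℝ).toLinearMap
    (contDiffAt_pi.2 fun i => contDiffAt_pi.2 fun j => ha i j)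

theorem fderiv_matrix_mul {m : Type*} [Fintype m] {a b : F → Matrix m m ℝ} {u : F}
    (ha : DifferentiableAt ℝ a u) (hb : DifferentiableAt ℝ b u) (X : F) :
    fderiv ℝ (fun v => a v * b v) u X = fderiv ℝ a u X * b u + a u * fderiv ℝ b u X := by
  classical
  exact (DFunLike.congr_fun (fderiv_fun_mul' ha hb) X).trans (add_comm _ _)

theorem contDiffAt_matrix_inv {m : Type*} [Fintype m] [DecidableEq m] {k : WithTop ℕ∞}
    {a : F → Matrix m m ℝ} {u : F} (ha : ContDiffAt ℝ k a u) (h : IsUnit (a u).det) :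
    ContDiffAt ℝ k (fun v => (a v)⁻¹) u := by
  obtain ⟨x, hx⟩ := (Matrix.isUnit_iff_isUnit_det _).2 h
  simp only [Matrix.nonsing_inv_eq_ringInverse]
  exact (hx ▸ contDiffAt_ringInverse ℝ x).comp u ha

theorem fderiv_matrix_inv {m : Type*} [Fintype m] [DecidableEq m]
    {a : F → Matrix m m ℝ} {u : F} (ha : DifferentiableAt ℝ a u) (h : IsUnit (a u).det) (X : F) :
    fderiv ℝ (fun v => (a v)⁻¹) u X = -((a u)⁻¹ * fderiv ℝ a u X * (a u)⁻¹) := by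
  obtain ⟨x, hx⟩ := (Matrix.isUnit_iff_isUnit_det _).2 h
  simp only [Matrix.nonsing_inv_eq_ringInverse]
  have hinv := hasFDerivAt_ringInverse (𝕜 := ℝ) x
  rw [← Ring.inverse_unit, hx] at hinv
  exact DFunLike.congr_fun (hinv.comp u ha.hasFDerivAt).fderiv X

end Calculus

/-! ### Matrices acting on coordinate forms -/

section MatrixAction

open ExteriorAlgebra (ι)

variable {n : ℕ}

theorem intProd_comm (i j : Fin n) (a : CoordAlg n) :
    intProd i (intProd j a) = -intProd j (intProd i a) :=
  CliffordAlgebra.contractLeft_comm (Q := 0) _ _ a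

theorem intProd_eq_contractLeft_coord (i : Fin n) :
    intProd i = CliffordAlgebra.contractLeft (Q := 0) ((coframe n).coord i) := by
  rw [intProd]
  congr 1
  ext α
  exact ((frame n).dualBasis_repr α i).symm

theorem sum_apply_frame_smul_coframe (α : Module.Dual ℝ (Coord n)) :
    ∑ l, α (frame n l) • coframe n l = α := by
  simp [coframe, Module.Basis.coe_dualBasis]

/-- The endomorphism `dxˡ ↦ ∑ aˡₘ dxᵐ` of `(ℝⁿ)*`, i.e. the transpose of the endomorphism of `ℝⁿ`
with matrix `a`. -/
def coEnd : Matrix (Fin n) (Fin n) ℝ →ₗ[ℝ] Module.End ℝ (Module.Dual ℝ (Coord n)) :=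
  Module.Dual.transpose ∘ₗ (Matrix.toLin (frame n) (frame n)).toLinearMap

theorem coEnd_apply (a : Matrix (Fin n) (Fin n) ℝ) (α : Module.Dual ℝ (Coord n)) :
    coEnd a α = α ∘ₗ Matrix.toLin (frame n) (frame n) a :=
  rfl

theorem coEnd_coframe (a : Matrix (Fin n) (Fin n) ℝ) (l : Fin n) :
    coEnd a (coframe n l) = ∑ m, a l m • coframe n m := by
  refine (sum_apply_frame_smul_coframe _).symm.trans (Finset.sum_congr rfl fun m _ => ?_)
  simp [coEnd_apply, Matrix.toLin_self, coframe, Finsupp.single_apply]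

theorem coEnd_mul (a b : Matrix (Fin n) (Fin n) ℝ) : coEnd (a * b) = coEnd b ∘ₗ coEnd a := by
  ext1 α
  simp only [coEnd_apply, LinearMap.comp_apply, Matrix.toLin_mul (frame n) (frame n),
    LinearMap.comp_assoc]

theorem coEnd_toMatrix (L : Coord n →ₗ[ℝ] Coord n) :
    coEnd (LinearMap.toMatrix (frame n) (frame n) L) = Module.Dual.transpose L := by
  rw [coEnd, LinearMap.comp_apply, LinearEquiv.coe_coe, Matrix.toLin_toMatrix]

/-- The algebra endomorphism `dxˡ ↦ ∑ aˡₘ dxᵐ` of `Λ((ℝⁿ)*)`: the pullback under the linear map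
with matrix `a`. -/
def coMap (a : Matrix (Fin n) (Fin n) ℝ) : CoordAlg n →ₐ[ℝ] CoordAlg n :=
  ExteriorAlgebra.map (coEnd a)

theorem coMap_ι (a : Matrix (Fin n) (Fin n) ℝ) (α : Module.Dual ℝ (Coord n)) :
    coMap a (ι ℝ α) = ι ℝ (coEnd a α) :=
  ExteriorAlgebra.map_apply_ι _ α

theorem coMap_coMap (a b : Matrix (Fin n) (Fin n) ℝ) (c : CoordAlg n) :
    coMap b (coMap a c) = coMap (a * b) c := by
  rw [coMap, coMap, coMap, coEnd_mul, ← ExteriorAlgebra.map_comp_map, AlgHom.comp_apply]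

theorem coMap_one (c : CoordAlg n) : coMap 1 c = c := by
  have h : coEnd (1 : Matrix (Fin n) (Fin n) ℝ) = LinearMap.id := by
    rw [← LinearMap.toMatrix_id (frame n), coEnd_toMatrix]
    rfl
  rw [coMap, h, ExteriorAlgebra.map_id, AlgHom.id_apply]

theorem coMap_injective {a : Matrix (Fin n) (Fin n) ℝ} (ha : IsUnit a.det) :
    Function.Injective (coMap a) :=
  Function.LeftInverse.injective (g := coMap a⁻¹) fun c => by
    rw [coMap_coMap, Matrix.mul_nonsing_inv a ha, coMap_one]

theorem intProd_coMap (a : Matrix (Fin n) (Fin n) ℝ) (i : Fin n) (c : CoordAlg n) :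
    intProd i (coMap a c) = coMap a (∑ k, a k i • intProd k c) := by
  have h : Module.Dual.eval ℝ (Coord n) (frame n i) ∘ₗ coEnd a =
      ∑ k, a k i • Module.Dual.eval ℝ (Coord n) (frame n k) := by
    ext α
    simp [coEnd_apply, Matrix.toLin_self]
  rw [intProd, coMap, contractLeft_map, h]
  simp [intProd]

variable {F : Type*} [NormedAddCommGroup F] [NormedSpace ℝ F]
  {B : F → Matrix (Fin n) (Fin n) ℝ} {θ : F → CoordAlg n} {u : F}

/-- `coMap` as a function with values in the continuous linear maps. -/
def coMapL (a : Matrix (Fin n) (Fin n) ℝ) : CoordAlg n →L[ℝ] CoordAlg n :=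
  (coMap a).toLinearMap.toContinuousLinearMap

theorem contDiffAt_coMapL {k : WithTop ℕ∞} (hB : ContDiffAt ℝ k B u) :
    ContDiffAt ℝ k (fun v => coMapL (B v)) u := by
  refine contDiffAt_clm_of_forall fun c => ?_
  change ContDiffAt ℝ k (fun v => coMap (B v) c) u
  induction c using ExteriorAlgebra.induction with
  | algebraMap r => simpa only [AlgHom.commutes] using contDiffAt_const
  | ι α =>
    simp only [coMap_ι]
    exact contDiffAt_linearMap_comp (ι ℝ ∘ₗ coEnd.flip α) hB
  | mul a b ha hb => simpa only [map_mul] using contDiffAt_wedge ha hb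
  | add a b ha hb => simpa only [map_add] using ha.add hb

theorem contDiffAt_coMap {k : WithTop ℕ∞} (hB : ContDiffAt ℝ k B u) (hθ : ContDiffAt ℝ k θ u) :
    ContDiffAt ℝ k (fun v => coMap (B v) (θ v)) u :=
  (contDiffAt_coMapL hB).clm_apply hθ

theorem fderiv_coMap_const (hB : ContDiffAt ℝ 1 B u) {X : F} {A A' : Matrix (Fin n) (Fin n) ℝ}
    (h : fderiv ℝ B u X = B u * A' - A * B u) (c : CoordAlg n) :
    fderiv ℝ (fun v => coMap (B v) c) u X =
      derivExt (coframe n) (coEnd A') (coMap (B u) c) -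
        coMap (B u) (derivExt (coframe n) (coEnd A) c) := by
  have hd (c : CoordAlg n) : DifferentiableAt ℝ (fun v => coMap (B v) c) u :=
    (contDiffAt_coMap hB contDiffAt_const).differentiableAt one_ne_zero
  induction c using ExteriorAlgebra.induction with
  | algebraMap r => simp [derivExt_algebraMap]
  | ι α =>
    simp only [coMap_ι, derivExt_ι]
    refine (fderiv_linearMap_comp (ι ℝ ∘ₗ coEnd.flip α)
      (hB.differentiableAt one_ne_zero) X).trans ?_
    change ι ℝ (coEnd (fderiv ℝ B u X) α) = _
    rw [h]
    simp only [map_sub, coEnd_mul, LinearMap.sub_apply, LinearMap.comp_apply]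
  | mul a b ha hb =>
    simp only [map_mul, fderiv_wedge (hd a) (hd b), ha, hb, derivExt_mul, map_add]
    noncomm_ring
  | add a b ha hb =>
    simp only [map_add, fderiv_fun_add (hd a) (hd b), add_apply, ha, hb]
    abel

/-- The gauge transformation law of the covariant derivatives `∂ - A` and `∂ - A'` of forms. -/
theorem fderiv_coMap_sub_derivExt (hB : ContDiffAt ℝ 1 B u) (hθ : DifferentiableAt ℝ θ u) {X : F}
    {A A' : Matrix (Fin n) (Fin n) ℝ} (h : fderiv ℝ B u X = B u * A' - A * B u) :
    fderiv ℝ (fun v => coMap (B v) (θ v)) u X -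
        derivExt (coframe n) (coEnd A') (coMap (B u) (θ u)) =
      coMap (B u) (fderiv ℝ θ u X - derivExt (coframe n) (coEnd A) (θ u)) := by
  have hd : DifferentiableAt ℝ (fun v => coMapL (B v)) u :=
    (contDiffAt_coMapL hB).differentiableAt one_ne_zero
  have hconst : fderiv ℝ (fun v => coMapL (B v)) u X (θ u) =
      fderiv ℝ (fun v => coMap (B v) (θ u)) u X := by
    refine Eq.trans ?_ (DFunLike.congr_fun (fderiv_clm_apply hd (differentiableAt_const _)) X).symm
    simp
  have hprod : fderiv ℝ (fun v => coMap (B v) (θ v)) u X =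
      coMap (B u) (fderiv ℝ θ u X) + fderiv ℝ (fun v => coMapL (B v)) u X (θ u) :=
    DFunLike.congr_fun (fderiv_clm_apply hd hθ) X
  rw [hprod, hconst, fderiv_coMap_const hB h, map_sub]
  abel

end MatrixAction

/-! ### The Levi-Civita connection in coordinates -/

section LocalMetric

open Matrix

theorem fderiv_fderiv_comm {E F : Type*} [NormedAddCommGroup E] [NormedSpace ℝ E]
    [NormedAddCommGroup F] [NormedSpace ℝ F] {f : F → E} {u : F} (hf : ContDiffAt ℝ 2 f u)
    (X Y : F) :
    fderiv ℝ (fun v => fderiv ℝ f v Y) u X = fderiv ℝ (fun v => fderiv ℝ f v X) u Y := by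
  have hsymm : IsSymmSndFDerivAt ℝ f u :=
    hf.isSymmSndFDerivAt minSmoothness_of_isRCLikeNormedField.le
  have hd : DifferentiableAt ℝ (fderiv ℝ f) u :=
    (hf.fderiv_right (m := 1) one_add_one_eq_two.le).differentiableAt one_ne_zero
  have happly (X Y : F) : fderiv ℝ (fun v => fderiv ℝ f v Y) u X = fderiv ℝ (fderiv ℝ f) u X Y := by
    rw [fderiv_clm_apply hd (differentiableAt_const _)]
    simp
  rw [happly, happly]
  exact hsymm X Y

theorem contDiffAt_fderiv_apply {E F : Type*} [NormedAddCommGroup E] [NormedSpace ℝ E]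
    [NormedAddCommGroup F] [NormedSpace ℝ F] {f : F → E} {u : F} (hf : ContDiffAt ℝ ∞ f u)
    (X : F) : ContDiffAt ℝ ∞ (fun v => fderiv ℝ f v X) u :=
  (hf.fderiv_right (m := ∞) (by simp)).clm_apply contDiffAt_const

variable {n : ℕ}

/-- `g` is the component matrix of a metric on the open subset `U` of `ℝⁿ`. -/
structure IsLocalMetric (g : Coord n → Matrix (Fin n) (Fin n) ℝ) (U : Set (Coord n)) : Prop where
  isOpen : IsOpen U
  contDiffOn : ContDiffOn ℝ ∞ g U
  isSymm : ∀ u ∈ U, (g u).IsSymm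
  isUnit_det : ∀ u ∈ U, IsUnit (g u).det

/-- The matrix `(Γˡⱼₘ)ₗₘ` of the Levi-Civita connection along `∂ⱼ`. -/
def connMatrix (g : Coord n → Matrix (Fin n) (Fin n) ℝ) (j : Fin n) (u : Coord n) :
    Matrix (Fin n) (Fin n) ℝ :=
  Matrix.of fun l m => christoffel g l j m u

theorem pderiv_entry {g : Coord n → Matrix (Fin n) (Fin n) ℝ} {u : Coord n}
    (hg : DifferentiableAt ℝ g u) (i l m : Fin n) :
    pderiv i (fun v => g v l m) u = fderiv ℝ g u (frame n i) l m :=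
  fderiv_linearMap_comp (Matrix.entryLinearMap ℝ ℝ l m) hg _

namespace IsLocalMetric

variable {g : Coord n → Matrix (Fin n) (Fin n) ℝ} {U : Set (Coord n)} {u : Coord n}

theorem eventually_mem (hg : IsLocalMetric g U) (hu : u ∈ U) : ∀ᶠ v in nhds u, v ∈ U :=
  hg.isOpen.mem_nhds hu

theorem contDiffAt (hg : IsLocalMetric g U) (hu : u ∈ U) : ContDiffAt ℝ ∞ g u :=
  hg.contDiffOn.contDiffAt (hg.eventually_mem hu)

theorem differentiableAt (hg : IsLocalMetric g U) (hu : u ∈ U) : DifferentiableAt ℝ g u :=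
  (hg.contDiffAt hu).differentiableAt (by simp)

theorem contDiffAt_inv (hg : IsLocalMetric g U) (hu : u ∈ U) :
    ContDiffAt ℝ ∞ (fun v => (g v)⁻¹) u :=
  contDiffAt_matrix_inv (hg.contDiffAt hu) (hg.isUnit_det u hu)

theorem isSymm_fderiv (hg : IsLocalMetric g U) (hu : u ∈ U) (X : Coord n) :
    (fderiv ℝ g u X).IsSymm := by
  have h : (fun v => (g v)ᵀ) =ᶠ[nhds u] g := (hg.eventually_mem hu).mono hg.isSymm
  calc (fderiv ℝ g u X)ᵀ = fderiv ℝ (fun v => (g v)ᵀ) u X :=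
        (fderiv_linearMap_comp (transposeLinearEquiv (Fin n) (Fin n) ℝ ℝ).toLinearMap
          (hg.differentiableAt hu) X).symm
    _ = fderiv ℝ g u X := DFunLike.congr_fun h.fderiv_eq X

theorem contDiffAt_connMatrix (hg : IsLocalMetric g U) (hu : u ∈ U) (j : Fin n) :
    ContDiffAt ℝ ∞ (connMatrix g j) u := by
  have hpderiv (i l m : Fin n) : ContDiffAt ℝ ∞ (pderiv i fun v => g v l m) u :=
    contDiffAt_fderiv_apply (contDiffAt_matrix_iff.1 (hg.contDiffAt hu) l m) _
  refine contDiffAt_matrix_iff.2 fun l m => contDiffAt_const.mul (ContDiffAt.sum fun r _ => ?_)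
  exact (contDiffAt_matrix_iff.1 (hg.contDiffAt_inv hu) l r).mul
    (((hpderiv j r m).add (hpderiv m r j)).sub (hpderiv r j m))

theorem mul_connMatrix_apply (hg : IsLocalMetric g U) (hu : u ∈ U) (j r m : Fin n) :
    (g u * connMatrix g j u) r m =
      (fderiv ℝ g u (frame n j) r m + fderiv ℝ g u (frame n m) r j -
        fderiv ℝ g u (frame n r) j m) / 2 := by
  have h : connMatrix g j u = (g u)⁻¹ * Matrix.of fun r m =>
      (fderiv ℝ g u (frame n j) r m + fderiv ℝ g u (frame n m) r j -
        fderiv ℝ g u (frame n r) j m) / 2 := by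
    ext l m
    simp only [connMatrix, christoffel, of_apply, mul_apply, Finset.mul_sum,
      pderiv_entry (hg.differentiableAt hu)]
    exact Finset.sum_congr rfl fun r _ => by ring
  rw [h, mul_nonsing_inv_cancel_left _ _ (hg.isUnit_det u hu), of_apply]

theorem connMatrix_symm (hg : IsLocalMetric g U) (hu : u ∈ U) (j l m : Fin n) :
    connMatrix g j u l m = connMatrix g m u l j := by
  simp only [connMatrix, christoffel, of_apply, pderiv_entry (hg.differentiableAt hu)]
  congr! 3 with r
  rw [(hg.isSymm_fderiv hu _).apply m j, add_comm]

theorem metric_compatible_connMatrix (hg : IsLocalMetric g U) (hu : u ∈ U) (j : Fin n) :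
    fderiv ℝ g u (frame n j) = g u * connMatrix g j u + (g u * connMatrix g j u)ᵀ := by
  ext r m
  rw [Matrix.add_apply, transpose_apply, hg.mul_connMatrix_apply hu, hg.mul_connMatrix_apply hu,
    (hg.isSymm_fderiv hu _).apply m r, (hg.isSymm_fderiv hu _).apply j r,
    (hg.isSymm_fderiv hu _).apply j m]
  ring

theorem eq_connMatrix_of_torsionFree (hg : IsLocalMetric g U) (hu : u ∈ U)
    {A : Fin n → Matrix (Fin n) (Fin n) ℝ} (hsymm : ∀ j l m, A j l m = A m l j)
    (hcompat : ∀ j, fderiv ℝ g u (frame n j) = g u * A j + (g u * A j)ᵀ) (j : Fin n) :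
    A j = connMatrix g j u := by
  have hlow (j r m : Fin n) : (g u * A j) r m = (g u * A m) r j := by
    simp only [mul_apply, hsymm j _ m]
  have h : g u * A j = g u * connMatrix g j u := by
    ext r m
    rw [hg.mul_connMatrix_apply hu]
    simp only [hcompat, Matrix.add_apply, transpose_apply]
    rw [hlow m r j, hlow m j r, hlow j m r]
    ring
  rw [← nonsing_inv_mul_cancel_left _ (A j) (hg.isUnit_det u hu), h,
    nonsing_inv_mul_cancel_left _ _ (hg.isUnit_det u hu)]

theorem fderiv_inv (hg : IsLocalMetric g U) (hu : u ∈ U) (j : Fin n) :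
    fderiv ℝ (fun v => (g v)⁻¹) u (frame n j) =
      (g u)⁻¹ * -(connMatrix g j u)ᵀ - connMatrix g j u * (g u)⁻¹ := by
  have hdet := hg.isUnit_det u hu
  rw [fderiv_matrix_inv (hg.differentiableAt hu) hdet, hg.metric_compatible_connMatrix hu,
    transpose_mul, hg.isSymm u hu, Matrix.mul_add, nonsing_inv_mul_cancel_left _ _ hdet,
    Matrix.add_mul, ← Matrix.mul_assoc, mul_nonsing_inv_cancel_right _ _ hdet, Matrix.mul_neg]
  abel

theorem trace_connMatrix (hg : IsLocalMetric g U) (hu : u ∈ U) (j : Fin n) :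
    (connMatrix g j u).trace = ((g u)⁻¹ * fderiv ℝ g u (frame n j)).trace / 2 := by
  have hdet := hg.isUnit_det u hu
  rw [hg.metric_compatible_connMatrix hu, Matrix.mul_add, nonsing_inv_mul_cancel_left _ _ hdet,
    transpose_mul, hg.isSymm u hu, trace_add, trace_mul_comm, mul_nonsing_inv_cancel_right _ _ hdet,
    trace_transpose]
  ring

theorem sum_connMatrix (hg : IsLocalMetric g U) (hu : u ∈ U) (j : Fin n) :
    ∑ l, connMatrix g l u l j = (connMatrix g j u).trace :=
  Finset.sum_congr rfl fun l _ => hg.connMatrix_symm hu l l j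

/-- These traces `½ tr(g⁻¹ ∂ⱼ g)` are the components of `d log √|det g|`. -/
theorem pderiv_trace_connMatrix (hg : IsLocalMetric g U) (hu : u ∈ U) (i j : Fin n) :
    pderiv i (fun v => (connMatrix g j v).trace) u =
      pderiv j (fun v => (connMatrix g i v).trace) u := by
  have hd := hg.differentiableAt hu
  have hdd (j : Fin n) : DifferentiableAt ℝ (fun v => fderiv ℝ g v (frame n j)) u :=
    (contDiffAt_fderiv_apply (hg.contDiffAt hu) _).differentiableAt (by simp)
  have hinv : DifferentiableAt ℝ (fun v => (g v)⁻¹) u :=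
    (hg.contDiffAt_inv hu).differentiableAt (by simp)
  have hprod (i j : Fin n) :
      fderiv ℝ (fun v => (g v)⁻¹ * fderiv ℝ g v (frame n j)) u (frame n i) =
        (g u)⁻¹ * fderiv ℝ (fun v => fderiv ℝ g v (frame n j)) u (frame n i) -
          (g u)⁻¹ * fderiv ℝ g u (frame n i) * ((g u)⁻¹ * fderiv ℝ g u (frame n j)) := by
    have h := fderiv_matrix_mul hinv (hdd j) (frame n i)
    rw [fderiv_matrix_inv hd (hg.isUnit_det u hu)] at h
    rw [h, neg_mul, Matrix.mul_assoc _ (g u)⁻¹, add_comm, ← sub_eq_add_neg]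
  have htrace (i j : Fin n) : pderiv i (fun v => (connMatrix g j v).trace) u =
      (fderiv ℝ (fun v => (g v)⁻¹ * fderiv ℝ g v (frame n j)) u (frame n i)).trace / 2 := by
    have hev : (fun v => (connMatrix g j v).trace) =ᶠ[nhds u]
        fun v => ((g v)⁻¹ * fderiv ℝ g v (frame n j)).trace / 2 :=
      (hg.eventually_mem hu).mono fun v hv => hg.trace_connMatrix hv j
    rw [pderiv, hev.fderiv_eq]
    exact fderiv_linearMap_comp ((LinearMap.mulRight ℝ (2⁻¹ : ℝ)) ∘ₗ traceLinearMap (Fin n) ℝ ℝ)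
      (hinv.mul (hdd j)) _
  have hcomm : fderiv ℝ (fun v => fderiv ℝ g v (frame n j)) u (frame n i) =
      fderiv ℝ (fun v => fderiv ℝ g v (frame n i)) u (frame n j) :=
    fderiv_fderiv_comm ((hg.contDiffAt hu).of_le (by norm_cast)) _ _
  rw [htrace, htrace, hprod, hprod, hcomm, trace_sub, trace_sub, trace_mul_comm (_ * _) (_ * _)]

end IsLocalMetric

end LocalMetric

/-! ### The divergence in coordinates -/

section Divergence

open Matrix

variable {n : ℕ} {g : Coord n → Matrix (Fin n) (Fin n) ℝ} {u : Coord n}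
  {θ η ζ : Coord n → CoordAlg n}

theorem derivExt_coEnd (a : Matrix (Fin n) (Fin n) ℝ) (c : CoordAlg n) :
    derivExt (coframe n) (coEnd a) c =
      ∑ l, ∑ m, a l m • (ExteriorAlgebra.ι ℝ (coframe n m) * intProd l c) := by
  rw [derivExt_apply]
  refine Finset.sum_congr rfl fun l _ => ?_
  simp only [coEnd_coframe, map_sum, map_smul, Finset.sum_mul, smul_mul_assoc,
    intProd_eq_contractLeft_coord]

theorem coordNabla_eq (hθ : DifferentiableAt ℝ θ u) (j : Fin n) :
    coordNabla g j θ u =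
      fderiv ℝ θ u (frame n j) - derivExt (coframe n) (coEnd (connMatrix g j u)) (θ u) := by
  rw [coordNabla, formPDeriv_eq hθ, derivExt_coEnd]
  rfl

theorem coordDiv_congr (h : θ =ᶠ[nhds u] η) : coordDiv g θ u = coordDiv g η u := by
  have hcoeff (S : Finset (Fin n)) : (fun v => (formBasis n).repr (θ v) S) =ᶠ[nhds u]
      fun v => (formBasis n).repr (η v) S :=
    h.fun_comp fun c => (formBasis n).repr c S
  simp only [coordDiv, coordNabla, formPDeriv, pderiv, (hcoeff _).fderiv_eq, h.eq_of_nhds]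

theorem coordNabla_mul (hθ : DifferentiableAt ℝ θ u) (hη : DifferentiableAt ℝ η u) (j : Fin n) :
    coordNabla g j (fun v => θ v * η v) u =
      coordNabla g j θ u * η u + θ u * coordNabla g j η u := by
  rw [coordNabla_eq (differentiableAt_wedge hθ hη), coordNabla_eq hθ, coordNabla_eq hη,
    fderiv_wedge hθ hη, derivExt_mul]
  noncomm_ring

theorem coordNabla_mem {p : ℕ} (hθ : DifferentiableAt ℝ θ u)
    (h : ∀ᶠ v in nhds u, θ v ∈ ⋀[ℝ]^p (Module.Dual ℝ (Coord n))) (j : Fin n) :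
    coordNabla g j θ u ∈ ⋀[ℝ]^p (Module.Dual ℝ (Coord n)) := by
  rw [coordNabla_eq hθ]
  exact Submodule.sub_mem _ (fderiv_mem_submodule _ h _) (derivExt_mem _ _ h.self_of_nhds)

theorem coordDiv_mem {p : ℕ} (hθ : DifferentiableAt ℝ θ u)
    (h : ∀ᶠ v in nhds u, θ v ∈ ⋀[ℝ]^(p + 1) (Module.Dual ℝ (Coord n))) :
    coordDiv g θ u ∈ ⋀[ℝ]^p (Module.Dual ℝ (Coord n)) :=
  Submodule.sum_mem _ fun _ _ => Submodule.sum_mem _ fun j _ =>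
    Submodule.smul_mem _ _ (contractLeft_mem _ (coordNabla_mem hθ h j))

theorem coordDiv_eq_zero (hθ : DifferentiableAt ℝ θ u)
    (h : ∀ᶠ v in nhds u, θ v ∈ ⋀[ℝ]^0 (Module.Dual ℝ (Coord n))) :
    coordDiv g θ u = 0 := by
  refine Finset.sum_eq_zero fun i _ => Finset.sum_eq_zero fun j _ => ?_
  rw [intProd, contractLeft_of_mem_zero _ (coordNabla_mem hθ h j), smul_zero]

theorem coordDiv_add (hθ : DifferentiableAt ℝ θ u) (hη : DifferentiableAt ℝ η u) :
    coordDiv g (fun v => θ v + η v) u = coordDiv g θ u + coordDiv g η u := by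
  simp only [coordDiv, ← Finset.sum_add_distrib, ← smul_add, ← map_add]
  refine Finset.sum_congr rfl fun i _ => Finset.sum_congr rfl fun j _ => ?_
  rw [coordNabla_eq hθ, coordNabla_eq hη, coordNabla_eq (hθ.fun_add hη), fderiv_fun_add hθ hη,
    map_add, _root_.add_apply, add_sub_add_comm]

theorem coordDiv_smul (hθ : DifferentiableAt ℝ θ u) {a : Coord n → ℝ}
    (ha : DifferentiableAt ℝ a u) :
    coordDiv g (fun v => a v • θ v) u = a u • coordDiv g θ u +
      ∑ i, ∑ j, ((g u)⁻¹ i j * pderiv j a u) • intProd i (θ u) := by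
  have hnabla (j : Fin n) : coordNabla g j (fun v => a v • θ v) u =
      a u • coordNabla g j θ u + pderiv j a u • θ u := by
    rw [coordNabla_eq hθ, coordNabla_eq (ha.fun_smul hθ), fderiv_fun_smul ha hθ, map_smul,
      _root_.add_apply, _root_.smul_apply, ContinuousLinearMap.smulRight_apply, smul_sub, pderiv]
    abel
  simp only [coordDiv, hnabla, map_add, map_smul, smul_add, Finset.smul_sum,
    Finset.sum_add_distrib, mul_smul, smul_comm (a u)]

theorem coordDiv_const_smul (hθ : DifferentiableAt ℝ θ u) (r : ℝ) :
    coordDiv g (fun v => r • θ v) u = r • coordDiv g θ u := by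
  simpa only [pderiv, fderiv_fun_const, Pi.zero_apply, _root_.zero_apply, mul_zero, zero_smul,
    Finset.sum_const_zero, add_zero] using coordDiv_smul (g := g) hθ (differentiableAt_const r)

theorem coordDiv_seven_term {p q : ℕ} (hθ : DifferentiableAt ℝ θ u) (hη : DifferentiableAt ℝ η u)
    (hζ : DifferentiableAt ℝ ζ u)
    (hp : ∀ᶠ v in nhds u, θ v ∈ ⋀[ℝ]^p (Module.Dual ℝ (Coord n)))
    (hq : ∀ᶠ v in nhds u, η v ∈ ⋀[ℝ]^q (Module.Dual ℝ (Coord n))) :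
    coordDiv g (fun v => θ v * η v * ζ v) u =
      coordDiv g (fun v => θ v * η v) u * ζ u + (-1) ^ p * (θ u * coordDiv g (fun v => η v * ζ v) u)
        + (-1) ^ ((p + 1) * q) * (η u * coordDiv g (fun v => θ v * ζ v) u)
        - coordDiv g θ u * η u * ζ u - (-1) ^ p * (θ u * coordDiv g η u * ζ u)
        - (-1) ^ (p + q) * (θ u * η u * coordDiv g ζ u) := by
  simp only [coordDiv, Finset.mul_sum, Finset.sum_mul, ← Finset.sum_add_distrib,
    ← Finset.sum_sub_distrib]
  refine Finset.sum_congr rfl fun i _ => Finset.sum_congr rfl fun j _ => ?_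
  simp only [mul_smul_comm, smul_mul_assoc, ← smul_add, ← smul_sub]
  congr 1
  rw [coordNabla_mul (differentiableAt_wedge hθ hη) hζ, coordNabla_mul hθ hη, coordNabla_mul hη hζ,
    coordNabla_mul hθ hζ, add_mul (coordNabla g j θ u * η u)]
  exact seven_term_of_derivation _ hp.self_of_nhds (coordNabla_mem hθ hp j) hq.self_of_nhds
    (coordNabla_mem hη hq j) _ _

variable {U : Set (Coord n)}

theorem contDiffAt_coordDiv (hg : IsLocalMetric g U) (hu : u ∈ U) (hθ : ContDiffAt ℝ ∞ θ u) :
    ContDiffAt ℝ ∞ (coordDiv g θ) u := by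
  have hΓ (l j m : Fin n) : ContDiffAt ℝ ∞ (christoffel g l j m) u :=
    contDiffAt_matrix_iff.1 (hg.contDiffAt_connMatrix hu j) l m
  have hcontract (l : Fin n) : ContDiffAt ℝ ∞ (fun v => intProd l (θ v)) u :=
    contDiffAt_linearMap_comp _ hθ
  have hpderiv (j : Fin n) : ContDiffAt ℝ ∞ (formPDeriv j θ) u :=
    ContDiffAt.sum fun S _ =>
      (contDiffAt_fderiv_apply (contDiffAt_form_iff.1 hθ S) _).fun_smul contDiffAt_const
  exact ContDiffAt.sum fun i _ => ContDiffAt.sum fun j _ =>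
    (contDiffAt_matrix_iff.1 (hg.contDiffAt_inv hu) i j).fun_smul
      (contDiffAt_linearMap_comp _ ((hpderiv j).sub (ContDiffAt.sum fun l _ => ContDiffAt.sum
        fun m _ => (hΓ l j m).fun_smul (contDiffAt_wedge contDiffAt_const (hcontract l)))))

theorem sum_intProd_intProd_of_symm {S : Fin n → Fin n → CoordAlg n} (hS : ∀ k j, S j k = S k j) :
    ∑ k, ∑ j, intProd k (intProd j (S k j)) = 0 := by
  have : IsAddTorsionFree (CoordAlg n) := .of_isTorsionFree ℝ (CoordAlg n)
  refine self_eq_neg.1 ?_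
  conv_lhs => rw [Finset.sum_comm]
  simp only [← Finset.sum_neg_distrib]
  refine Finset.sum_congr rfl fun k _ => Finset.sum_congr rfl fun j _ => ?_
  rw [intProd_comm, hS]

theorem sum_intProd_derivExt_of_symm {Γ : Fin n → Matrix (Fin n) (Fin n) ℝ}
    (hΓ : ∀ j l m, Γ j l m = Γ m l j) (P : CoordAlg n) :
    ∑ j, intProd j (derivExt (coframe n) (coEnd (Γ j)ᵀ) P) =
      ∑ j, (∑ l, Γ l l j) • intProd j P := by
  have hcontract (j l m : Fin n) :
      intProd j (ExteriorAlgebra.ι ℝ (coframe n m) * intProd l P) =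
        (if m = j then intProd l P else 0) -
          ExteriorAlgebra.ι ℝ (coframe n m) * intProd j (intProd l P) := by
    rw [intProd_eq_contractLeft_coord, contractLeft_ι_mul, Module.Basis.coord_apply,
      Module.Basis.repr_self, Finsupp.single_apply, ite_smul, one_smul, zero_smul]
  have hzero : ∑ j, ∑ l, ∑ m, Γ j m l •
      (ExteriorAlgebra.ι ℝ (coframe n m) * intProd j (intProd l P)) = 0 := by
    have hfactor (m : Fin n) : ∑ j, ∑ l, Γ j m l •
        (ExteriorAlgebra.ι ℝ (coframe n m) * intProd j (intProd l P)) = 0 := by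
      simp only [← mul_smul_comm, ← map_smul, ← Finset.mul_sum]
      rw [sum_intProd_intProd_of_symm fun k j => by rw [hΓ], mul_zero]
    rw [Finset.sum_comm_cycle]
    exact Finset.sum_eq_zero fun m _ => hfactor m
  simp only [derivExt_coEnd, map_sum, map_smul, hcontract, smul_sub, Finset.sum_sub_distrib,
    transpose_apply, hzero, sub_zero, smul_ite, smul_zero, Finset.sum_ite_eq', Finset.mem_univ,
    if_true, Finset.sum_smul]
  exact Finset.sum_comm

/-- The derivative `∂ⱼ + wⱼ` of forms on `ℝⁿ` twisted by the functions `w`. -/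
def twistedDeriv (w : Fin n → Coord n → ℝ) (j : Fin n) (P : Coord n → CoordAlg n) (u : Coord n) :
    CoordAlg n :=
  fderiv ℝ P u (frame n j) + w j u • P u

/-- The divergence `∑ ι_{dxʲ} (∂ⱼ + wⱼ)` of a polyvector field with respect to a density `e^f` with
`wⱼ = ∂ⱼ f`. The polyvectors are elements of `CoordAlg n`, with `∂ⱼ` encoded as `dxʲ`. -/
def polyDiv (w : Fin n → Coord n → ℝ) (P : Coord n → CoordAlg n) (u : Coord n) : CoordAlg n :=
  ∑ j, intProd j (twistedDeriv w j P u)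

variable {w : Fin n → Coord n → ℝ} {P Q : Coord n → CoordAlg n}

theorem differentiableAt_twistedDeriv (hw : ∀ j, DifferentiableAt ℝ (w j) u)
    (hP : ContDiffAt ℝ ∞ P u) (j : Fin n) : DifferentiableAt ℝ (twistedDeriv w j P) u :=
  ((contDiffAt_fderiv_apply hP _).differentiableAt (by simp)).fun_add
    ((hw j).fun_smul (hP.differentiableAt (by simp)))

theorem twistedDeriv_comm (hw : ∀ j, DifferentiableAt ℝ (w j) u)
    (hclosed : ∀ i j, pderiv i (w j) u = pderiv j (w i) u) (hP : ContDiffAt ℝ ∞ P u)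
    (j k : Fin n) :
    twistedDeriv w j (twistedDeriv w k P) u = twistedDeriv w k (twistedDeriv w j P) u := by
  have hexpand (j k : Fin n) : twistedDeriv w j (twistedDeriv w k P) u =
      fderiv ℝ (fun v => fderiv ℝ P v (frame n k)) u (frame n j) + pderiv j (w k) u • P u +
        (w k u • fderiv ℝ P u (frame n j) + w j u • fderiv ℝ P u (frame n k)) +
        (w j u * w k u) • P u := by
    have hPd : DifferentiableAt ℝ P u := hP.differentiableAt (by simp)
    have h : fderiv ℝ (twistedDeriv w k P) u = _ :=
      fderiv_fun_add ((contDiffAt_fderiv_apply hP (frame n k)).differentiableAt (by simp))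
        ((hw k).fun_smul hPd)
    rw [twistedDeriv, h, fderiv_fun_smul (hw k) hPd]
    simp only [twistedDeriv, pderiv, _root_.add_apply, _root_.smul_apply,
      ContinuousLinearMap.smulRight_apply, smul_add, mul_smul]
    abel
  rw [hexpand, hexpand, fderiv_fderiv_comm (hP.of_le (by norm_cast)), hclosed j k, mul_comm (w j u),
    add_comm (w k u • _)]

theorem polyDiv_congr (h : P =ᶠ[nhds u] Q) : polyDiv w P u = polyDiv w Q u := by
  simp only [polyDiv, twistedDeriv, h.fderiv_eq, h.eq_of_nhds]

/-- The twisted derivatives commute and the contractions anticommute. -/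
theorem polyDiv_polyDiv (hw : ∀ j, DifferentiableAt ℝ (w j) u)
    (hclosed : ∀ i j, pderiv i (w j) u = pderiv j (w i) u) (hP : ContDiffAt ℝ ∞ P u) :
    polyDiv w (polyDiv w P) u = 0 := by
  have hD (j : Fin n) := differentiableAt_twistedDeriv hw hP j
  have hcomm (k : Fin n) : twistedDeriv w k (polyDiv w P) u =
      ∑ j, intProd j (twistedDeriv w k (twistedDeriv w j P) u) := by
    have h : fderiv ℝ (polyDiv w P) u = _ :=
      fderiv_fun_sum fun j _ => differentiableAt_linearMap_comp (intProd j) (hD j)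
    rw [twistedDeriv, h, _root_.sum_apply, polyDiv, Finset.smul_sum, ← Finset.sum_add_distrib]
    refine Finset.sum_congr rfl fun j _ => ?_
    rw [fderiv_linearMap_comp _ (hD j), ← map_smul, ← map_add]
    rfl
  rw [polyDiv]
  simp only [hcomm, map_sum]
  exact sum_intProd_intProd_of_symm fun k j => twistedDeriv_comm hw hclosed hP j k

/-- Raising indices, i.e. replacing `dxⁱ` by `∑ gⁱʲ ∂ⱼ`, identifies the divergence of `g` with the
polyvector divergence of the density `√|det g|`. -/
theorem coMap_inv_coordDiv (hg : IsLocalMetric g U) (hu : u ∈ U) (hθ : DifferentiableAt ℝ θ u) :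
    coMap (g u)⁻¹ (coordDiv g θ u) =
      polyDiv (fun j v => (connMatrix g j v).trace) (fun v => coMap (g v)⁻¹ (θ v)) u := by
  have hnabla (j : Fin n) : coMap (g u)⁻¹ (coordNabla g j θ u) =
      fderiv ℝ (fun v => coMap (g v)⁻¹ (θ v)) u (frame n j) +
        derivExt (coframe n) (coEnd (connMatrix g j u)ᵀ) (coMap (g u)⁻¹ (θ u)) := by
    rw [coordNabla_eq hθ, ← fderiv_coMap_sub_derivExt ((hg.contDiffAt_inv hu).of_le (by simp)) hθ
      (hg.fderiv_inv hu j), map_neg, map_neg, LinearMap.neg_apply, sub_neg_eq_add]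
  have hcontract : coMap (g u)⁻¹ (coordDiv g θ u) =
      ∑ j, intProd j (coMap (g u)⁻¹ (coordNabla g j θ u)) := by
    simp only [coordDiv, intProd_coMap, map_sum, map_smul]
    exact Finset.sum_comm
  simp only [hcontract, hnabla, polyDiv, twistedDeriv, map_add, map_smul, Finset.sum_add_distrib,
    sum_intProd_derivExt_of_symm (hg.connMatrix_symm hu), hg.sum_connMatrix hu]

theorem coordDiv_coordDiv (hg : IsLocalMetric g U) (hu : u ∈ U) (hθ : ContDiffOn ℝ ∞ θ U) :
    coordDiv g (coordDiv g θ) u = 0 := by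
  have hθat (v : Coord n) (hv : v ∈ U) : ContDiffAt ℝ ∞ θ v :=
    hθ.contDiffAt (hg.eventually_mem hv)
  have htrace (j : Fin n) : DifferentiableAt ℝ (fun v => (connMatrix g j v).trace) u :=
    differentiableAt_linearMap_comp (traceLinearMap (Fin n) ℝ ℝ)
      ((hg.contDiffAt_connMatrix hu j).differentiableAt (by simp))
  have hraise : (fun v => coMap (g v)⁻¹ (coordDiv g θ v)) =ᶠ[nhds u]
      polyDiv (fun j v => (connMatrix g j v).trace) fun v => coMap (g v)⁻¹ (θ v) :=
    (hg.eventually_mem hu).mono fun v hv =>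
      coMap_inv_coordDiv hg hv ((hθat v hv).differentiableAt (by simp))
  refine coMap_injective (isUnit_nonsing_inv_det_iff.2 (hg.isUnit_det u hu)) ?_
  rw [map_zero, coMap_inv_coordDiv hg hu
      ((contDiffAt_coordDiv hg hu (hθat u hu)).differentiableAt (by simp)),
    polyDiv_congr hraise]
  exact polyDiv_polyDiv htrace (hg.pderiv_trace_connMatrix hu)
    (contDiffAt_coMap (hg.contDiffAt_inv hu) (hθat u hu))

end Divergence

/-! ### Change of coordinates -/

section ChangeOfCoordinates

open Matrix

variable {n : ℕ} {τ : Coord n → Coord n} {u : Coord n}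

/-- The Jacobian matrix `(∂ᵣ τᵃ)ₐᵣ`. -/
def jacobian (τ : Coord n → Coord n) (u : Coord n) : Matrix (Fin n) (Fin n) ℝ :=
  LinearMap.toMatrix (frame n) (frame n) (fderiv ℝ τ u).toLinearMap

theorem fderiv_frame (τ : Coord n → Coord n) (u : Coord n) (j : Fin n) :
    fderiv ℝ τ u (frame n j) = ∑ k, jacobian τ u k j • frame n k := by
  simp only [jacobian, LinearMap.toMatrix_apply]
  exact ((frame n).sum_repr _).symm

theorem contDiffAt_jacobian (hτ : ContDiffAt ℝ ∞ τ u) : ContDiffAt ℝ ∞ (jacobian τ) u :=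
  contDiffAt_linearMap_comp
    ((LinearMap.toMatrix (frame n) (frame n)).toLinearMap ∘ₗ ContinuousLinearMap.coeLM ℝ)
    (hτ.fderiv_right (m := ∞) (by simp))

theorem differentiableAt_jacobian (hτ : ContDiffAt ℝ ∞ τ u) : DifferentiableAt ℝ (jacobian τ) u :=
  (contDiffAt_jacobian hτ).differentiableAt (by simp)

theorem fderiv_jacobian_symm (hτ : ContDiffAt ℝ ∞ τ u) (j a r : Fin n) :
    fderiv ℝ (jacobian τ) u (frame n j) a r = fderiv ℝ (jacobian τ) u (frame n r) a j := by
  have hentry (j r : Fin n) : fderiv ℝ (jacobian τ) u (frame n j) a r =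
      (frame n).coord a (fderiv ℝ (fun v => fderiv ℝ τ v (frame n r)) u (frame n j)) := by
    rw [← pderiv_entry (differentiableAt_jacobian hτ), ← fderiv_linearMap_comp _
      ((contDiffAt_fderiv_apply hτ _).differentiableAt (by simp))]
    simp only [pderiv, jacobian, LinearMap.toMatrix_apply]
    rfl
  rw [hentry, hentry, fderiv_fderiv_comm (hτ.of_le (by norm_cast))]

theorem fderiv_comp_frame {E : Type*} [NormedAddCommGroup E] [NormedSpace ℝ E] {f : Coord n → E}
    (hf : DifferentiableAt ℝ f (τ u)) (hτ : DifferentiableAt ℝ τ u) (j : Fin n) :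
    fderiv ℝ (fun v => f (τ v)) u (frame n j) =
      ∑ k, jacobian τ u k j • fderiv ℝ f (τ u) (frame n k) := by
  rw [fderiv_fun_comp u hf hτ, ContinuousLinearMap.comp_apply, fderiv_frame, map_sum]
  simp only [map_smul]

variable {g g' : Coord n → Matrix (Fin n) (Fin n) ℝ} {U U' : Set (Coord n)}

theorem isUnit_det_jacobian (hg' : IsLocalMetric g' U') (hu : u ∈ U')
    (h : g' u = (jacobian τ u)ᵀ * g (τ u) * jacobian τ u) : IsUnit (jacobian τ u).det := by
  have hdet := hg'.isUnit_det u hu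
  rw [h, det_mul] at hdet
  exact isUnit_of_mul_isUnit_right hdet

theorem jacobian_mul_inv_mul_transpose (hg' : IsLocalMetric g' U') (hu : u ∈ U')
    (h : g' u = (jacobian τ u)ᵀ * g (τ u) * jacobian τ u) :
    jacobian τ u * (g' u)⁻¹ * (jacobian τ u)ᵀ = (g (τ u))⁻¹ := by
  have hJ := isUnit_det_jacobian hg' hu h
  rw [h, Matrix.mul_inv_rev, Matrix.mul_inv_rev, ← Matrix.mul_assoc,
    mul_nonsing_inv _ hJ, Matrix.one_mul,
    nonsing_inv_mul_cancel_right _ _ (isUnit_det_transpose _ hJ)]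

theorem fderiv_metric_pullback (hg : IsLocalMetric g U) (hτu : τ u ∈ U) (hτ : ContDiffAt ℝ ∞ τ u)
    (h : ∀ᶠ v in nhds u, g' v = (jacobian τ v)ᵀ * g (τ v) * jacobian τ v) (j : Fin n) :
    fderiv ℝ g' u (frame n j) =
      (fderiv ℝ (jacobian τ) u (frame n j))ᵀ * g (τ u) * jacobian τ u +
        (jacobian τ u)ᵀ * (∑ k, jacobian τ u k j • fderiv ℝ g (τ u) (frame n k)) * jacobian τ u +
        (jacobian τ u)ᵀ * g (τ u) * fderiv ℝ (jacobian τ) u (frame n j) := by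
  have hJ := differentiableAt_jacobian hτ
  have hτd : DifferentiableAt ℝ τ u := hτ.differentiableAt (by simp)
  have hJt : DifferentiableAt ℝ (fun v => (jacobian τ v)ᵀ) u :=
    differentiableAt_linearMap_comp (transposeLinearEquiv (Fin n) (Fin n) ℝ ℝ).toLinearMap hJ
  have hJt' : fderiv ℝ (fun v => (jacobian τ v)ᵀ) u (frame n j) =
      (fderiv ℝ (jacobian τ) u (frame n j))ᵀ :=
    fderiv_linearMap_comp (transposeLinearEquiv (Fin n) (Fin n) ℝ ℝ).toLinearMap hJ _
  have hgτ : DifferentiableAt ℝ (fun v => g (τ v)) u := (hg.differentiableAt hτu).fun_comp' u hτd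
  have hgτ' : fderiv ℝ (fun v => g (τ v)) u (frame n j) =
      ∑ k, jacobian τ u k j • fderiv ℝ g (τ u) (frame n k) :=
    fderiv_comp_frame (hg.differentiableAt hτu) hτd j
  have hinner := fderiv_matrix_mul hJt hgτ (frame n j)
  have houter := fderiv_matrix_mul (hJt.fun_mul hgτ) hJ (frame n j)
  refine (DFunLike.congr_fun (Filter.EventuallyEq.fderiv_eq h) _).trans (houter.trans ?_)
  rw [hinner, hJt', hgτ', Matrix.add_mul]

theorem connMatrix_transformation_law (hg : IsLocalMetric g U) (hτu : τ u ∈ U)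
    (hg' : IsLocalMetric g' U') (hu : u ∈ U') (hτ : ContDiffAt ℝ ∞ τ u)
    (h : ∀ᶠ v in nhds u, g' v = (jacobian τ v)ᵀ * g (τ v) * jacobian τ v) (j : Fin n) :
    fderiv ℝ (jacobian τ) u (frame n j) = jacobian τ u * connMatrix g' j u -
      (∑ k, jacobian τ u k j • connMatrix g k (τ u)) * jacobian τ u := by
  have hgu := h.self_of_nhds
  have hJ := isUnit_det_jacobian hg' hu hgu
  set J := jacobian τ u with hJdef
  set C : Fin n → Matrix (Fin n) (Fin n) ℝ := fun j => ∑ k, J k j • connMatrix g k (τ u) with hC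
  set H : Fin n → Matrix (Fin n) (Fin n) ℝ := fun j => fderiv ℝ (jacobian τ) u (frame n j)
  have hCsymm (j a m : Fin n) : (C j * J) a m = (C m * J) a j := by
    simp only [hC, mul_apply, Matrix.sum_apply, Matrix.smul_apply, smul_eq_mul, Finset.sum_mul]
    rw [Finset.sum_comm]
    refine Finset.sum_congr rfl fun k _ => Finset.sum_congr rfl fun b _ => ?_
    rw [hg.connMatrix_symm hτu b a k]
    ring
  have hHsymm (j a m : Fin n) : H j a m = H m a j := fderiv_jacobian_symm hτ j a m
  have hCcompat (j : Fin n) : ∑ k, J k j • fderiv ℝ g (τ u) (frame n k) =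
      g (τ u) * C j + (g (τ u) * C j)ᵀ := by
    simp only [hC, hg.metric_compatible_connMatrix hτu, Matrix.mul_sum, transpose_sum,
      Matrix.mul_smul, transpose_smul, smul_add, Finset.sum_add_distrib]
  have hA : J⁻¹ * (C j * J + H j) = connMatrix g' j u := by
    refine hg'.eq_connMatrix_of_torsionFree hu (A := fun j => J⁻¹ * (C j * J + H j))
      (fun j l m => ?_) (fun j => ?_) j
    · simp only [Matrix.mul_apply (M := J⁻¹), Matrix.add_apply, hCsymm j _ m, hHsymm j _ m]
    · have hcancel : g' u * (J⁻¹ * (C j * J + H j)) = Jᵀ * g (τ u) * (C j * J + H j) := by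
        rw [hgu, Matrix.mul_assoc (Jᵀ * g (τ u)), mul_nonsing_inv_cancel_left _ _ hJ]
      rw [hcancel, fderiv_metric_pullback hg hτu hτ h, ← hJdef, hCcompat]
      change (H j)ᵀ * g (τ u) * J + _ + _ * H j = _
      simp only [transpose_mul, transpose_add, transpose_transpose, (hg.isSymm _ hτu).eq,
        Matrix.mul_add, Matrix.add_mul, Matrix.mul_assoc]
      abel
  rw [← hA, mul_nonsing_inv_cancel_left _ _ hJ, add_sub_cancel_left]

theorem coordNabla_pullback (hg : IsLocalMetric g U) (hτu : τ u ∈ U) (hg' : IsLocalMetric g' U')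
    (hu : u ∈ U') (hτ : ContDiffAt ℝ ∞ τ u)
    (h : ∀ᶠ v in nhds u, g' v = (jacobian τ v)ᵀ * g (τ v) * jacobian τ v)
    {θ : Coord n → CoordAlg n} (hθ : DifferentiableAt ℝ θ (τ u)) (j : Fin n) :
    coordNabla g' j (fun v => coMap (jacobian τ v) (θ (τ v))) u =
      coMap (jacobian τ u) (∑ k, jacobian τ u k j • coordNabla g k θ (τ u)) := by
  have hJ : ContDiffAt ℝ 1 (jacobian τ) u := (contDiffAt_jacobian hτ).of_le (by simp)
  have hτd : DifferentiableAt ℝ τ u := hτ.differentiableAt (by simp)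
  have hθτ : DifferentiableAt ℝ (fun v => θ (τ v)) u := hθ.fun_comp' u hτd
  have hpull : DifferentiableAt ℝ (fun v => coMap (jacobian τ v) (θ (τ v))) u :=
    ((contDiffAt_coMapL hJ).differentiableAt one_ne_zero).clm_apply hθτ
  rw [coordNabla_eq hpull, fderiv_coMap_sub_derivExt hJ hθτ
    (connMatrix_transformation_law hg hτu hg' hu hτ h j), fderiv_comp_frame hθ hτd]
  simp only [coordNabla_eq hθ, smul_sub, Finset.sum_sub_distrib, map_sum, map_smul,
    LinearMap.sum_apply, LinearMap.smul_apply]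

theorem coordDiv_pullback (hg : IsLocalMetric g U) (hτu : τ u ∈ U) (hg' : IsLocalMetric g' U')
    (hu : u ∈ U') (hτ : ContDiffAt ℝ ∞ τ u)
    (h : ∀ᶠ v in nhds u, g' v = (jacobian τ v)ᵀ * g (τ v) * jacobian τ v)
    {θ : Coord n → CoordAlg n} (hθ : DifferentiableAt ℝ θ (τ u)) :
    coordDiv g' (fun v => coMap (jacobian τ v) (θ (τ v))) u =
      coMap (jacobian τ u) (coordDiv g θ (τ u)) := by
  simp only [coordDiv, coordNabla_pullback hg hτu hg' hu hτ h hθ, intProd_coMap, ← map_smul,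
    ← map_sum, ← jacobian_mul_inv_mul_transpose hg' hu h.self_of_nhds]
  congr 1
  simp only [mul_apply, transpose_apply, map_sum, map_smul, Finset.sum_mul, Finset.sum_smul,
    Finset.smul_sum, smul_smul]
  rw [Finset.sum_comm_cycle]
  refine Finset.sum_congr rfl fun l _ => ?_
  rw [Finset.sum_comm_cycle]
  refine Finset.sum_congr rfl fun k _ => ?_
  rw [Finset.sum_comm]
  refine Finset.sum_congr rfl fun j _ => Finset.sum_congr rfl fun i _ => ?_
  congr 1
  ring

end ChangeOfCoordinates

/-! ### Charts -/

section Charts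

open ExteriorAlgebra Matrix

variable {n : ℕ} {M : Type*} [TopologicalSpace M] [ChartedSpace (EuclideanSpace ℝ (Fin n)) M]
  {φ ψ : OpenPartialHomeomorph M (EuclideanSpace ℝ (Fin n))} {u : Coord n}

theorem mdifferentiable_of_mem_maximalAtlas (hφ : φ ∈ IsManifold.maximalAtlas (𝓡 n) ∞ M) :
    φ.MDifferentiable (𝓡 n) (𝓡 n) :=
  ⟨(contMDiffOn_of_mem_maximalAtlas hφ).mdifferentiableOn (by simp),
    (contMDiffOn_symm_of_mem_maximalAtlas hφ).mdifferentiableOn (by simp)⟩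

theorem eventually_mem_target_and_symm_mem_source {X : Type*} [TopologicalSpace X]
    {φ ψ : OpenPartialHomeomorph X (EuclideanSpace ℝ (Fin n))} (hu : u ∈ ψ.target)
    (hu' : ψ.symm u ∈ φ.source) : ∀ᶠ v in nhds u, v ∈ ψ.target ∧ ψ.symm v ∈ φ.source :=
  (ψ.open_target.eventually_mem hu).and
    ((ψ.continuousAt_symm hu).eventually (φ.open_source.eventually_mem hu'))

theorem contDiffAt_transition (hφ : φ ∈ IsManifold.maximalAtlas (𝓡 n) ∞ M)
    (hψ : ψ ∈ IsManifold.maximalAtlas (𝓡 n) ∞ M) (hu : u ∈ ψ.target)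
    (hu' : ψ.symm u ∈ φ.source) : ContDiffAt ℝ ∞ (φ ∘ ψ.symm) u :=
  contMDiffAt_iff_contDiffAt.1 <|
    (contMDiffAt_of_mem_maximalAtlas hφ hu').comp u (contMDiffAt_symm_of_mem_maximalAtlas hψ hu)

theorem fderiv_transition (hφ : φ ∈ IsManifold.maximalAtlas (𝓡 n) ∞ M)
    (hψ : ψ ∈ IsManifold.maximalAtlas (𝓡 n) ∞ M) (hu : u ∈ ψ.target)
    (hu' : ψ.symm u ∈ φ.source) :
    fderiv ℝ (φ ∘ ψ.symm) u =
      (mfderiv (𝓡 n) (𝓡 n) φ (ψ.symm u)).comp (mfderiv (𝓡 n) (𝓡 n) ψ.symm u) := by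
  rw [← mfderiv_eq_fderiv]
  exact mfderiv_comp u ((mdifferentiable_of_mem_maximalAtlas hφ).mdifferentiableAt hu')
    ((mdifferentiable_of_mem_maximalAtlas hψ).mdifferentiableAt_symm hu)

theorem mfderiv_symm_comp_mfderiv (hφ : φ ∈ IsManifold.maximalAtlas (𝓡 n) ∞ M)
    (hu : u ∈ φ.target) :
    (mfderiv (𝓡 n) (𝓡 n) φ.symm u).comp (mfderiv (𝓡 n) (𝓡 n) φ (φ.symm u)) =
      ContinuousLinearMap.id ℝ (TangentSpace (𝓡 n) (φ.symm u)) := by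
  have h := (mdifferentiable_of_mem_maximalAtlas hφ).symm_comp_deriv (φ.map_target hu)
  rwa [φ.right_inv hu] at h

/-- The pullback under a chart of a covector at a point of `ℝⁿ`, extended to exterior algebras.
It undoes `localForm`. -/
def chartPullback (φ : OpenPartialHomeomorph M (EuclideanSpace ℝ (Fin n))) (x : M) :
    CoordAlg n →ₐ[ℝ] ExteriorAlgebra ℝ (Cotangent n M x) :=
  ExteriorAlgebra.map (Module.Dual.transpose (R := ℝ) (M := TangentSpace (𝓡 n) x) (M' := Coord n)
    (mfderiv (𝓡 n) (𝓡 n) φ x).toLinearMap)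

theorem chartPullback_localForm (hφ : φ ∈ IsManifold.maximalAtlas (𝓡 n) ∞ M) (θ : RoughForm n M)
    (hu : u ∈ φ.target) : chartPullback φ (φ.symm u) (localForm φ θ u) = θ (φ.symm u) :=
  map_transpose_map_transpose_of_comp_eq_id
    (congrArg ContinuousLinearMap.toLinearMap (mfderiv_symm_comp_mfderiv hφ hu)) (θ (φ.symm u))

theorem chartPullback_localForm_apply (hφ : φ ∈ IsManifold.maximalAtlas (𝓡 n) ∞ M)
    (θ : RoughForm n M) {x : M} (hx : x ∈ φ.source) :
    chartPullback φ x (localForm φ θ (φ x)) = θ x := by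
  have h := chartPullback_localForm hφ θ (φ.map_source hx)
  rwa [φ.left_inv hx] at h

theorem localForm_chartPullback (hφ : φ ∈ IsManifold.maximalAtlas (𝓡 n) ∞ M)
    (hψ : ψ ∈ IsManifold.maximalAtlas (𝓡 n) ∞ M) (hu : u ∈ ψ.target) (hu' : ψ.symm u ∈ φ.source)
    {θ : RoughForm n M} {c : CoordAlg n} (hθ : θ (ψ.symm u) = chartPullback φ (ψ.symm u) c) :
    localForm ψ θ u = coMap (jacobian (φ ∘ ψ.symm) u) c := by
  rw [localForm, hθ, coMap, jacobian, coEnd_toMatrix, fderiv_transition hφ hψ hu hu']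
  exact map_transpose_map_transpose _ _ c

theorem localForm_transition (hφ : φ ∈ IsManifold.maximalAtlas (𝓡 n) ∞ M)
    (hψ : ψ ∈ IsManifold.maximalAtlas (𝓡 n) ∞ M) (θ : RoughForm n M) (hu : u ∈ ψ.target)
    (hu' : ψ.symm u ∈ φ.source) :
    localForm ψ θ u = coMap (jacobian (φ ∘ ψ.symm) u) (localForm φ θ (φ (ψ.symm u))) :=
  localForm_chartPullback hφ hψ hu hu' (chartPullback_localForm_apply hφ θ hu').symm

/-- The basis `∂₁, …, ∂ₙ` of the tangent space given by a chart. -/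
def chartBasis (hφ : φ ∈ IsManifold.maximalAtlas (𝓡 n) ∞ M) (hu : u ∈ φ.target) :
    Module.Basis (Fin n) ℝ (TangentSpace (𝓡 n) (φ.symm u)) :=
  (frame n).map ((mdifferentiable_of_mem_maximalAtlas hφ).symm.mfderiv
    (show u ∈ φ.symm.source from hu)).toLinearEquiv

theorem components_eq_toMatrix (hφ : φ ∈ IsManifold.maximalAtlas (𝓡 n) ∞ M) (g : Metric n M)
    (hu : u ∈ φ.target) :
    g.components φ u = LinearMap.BilinForm.toMatrix (chartBasis hφ hu) (g.val (φ.symm u)) := by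
  ext i j
  rw [LinearMap.BilinForm.toMatrix_apply]
  rfl

theorem isLocalMetric_components (hφ : φ ∈ IsManifold.maximalAtlas (𝓡 n) ∞ M) (g : Metric n M) :
    IsLocalMetric (g.components φ) φ.target where
  isOpen := φ.open_target
  contDiffOn u hu := (contDiffAt_matrix_iff.2 fun i j =>
    (g.smooth φ hφ i j).contDiffAt (φ.open_target.mem_nhds hu)).contDiffWithinAt
  isSymm _ _ := Matrix.ext fun _ _ => g.symm _ _ _
  isUnit_det u hu := by
    rw [components_eq_toMatrix hφ g hu, isUnit_iff_ne_zero]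
    exact (LinearMap.BilinForm.nondegenerate_iff_det_ne_zero _).1 (g.nondegenerate _)

/-- The bilinear form on `ℝⁿ` that a metric induces in a chart, so that `g.components φ u` is its
matrix. -/
def Metric.chartForm (g : Metric n M) (φ : OpenPartialHomeomorph M (EuclideanSpace ℝ (Fin n)))
    (u : Coord n) : LinearMap.BilinForm ℝ (Coord n) :=
  LinearMap.BilinForm.comp (M := Coord n) (M' := TangentSpace (𝓡 n) (φ.symm u)) (g.val (φ.symm u))
    (mfderiv (𝓡 n) (𝓡 n) φ.symm u).toLinearMap (mfderiv (𝓡 n) (𝓡 n) φ.symm u).toLinearMap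

theorem toMatrix_chartForm (g : Metric n M) (u : Coord n) :
    LinearMap.BilinForm.toMatrix (frame n) (g.chartForm φ u) = g.components φ u := by
  ext i j
  rw [LinearMap.BilinForm.toMatrix_apply]
  rfl

theorem chartForm_mfderiv (hφ : φ ∈ IsManifold.maximalAtlas (𝓡 n) ∞ M) (g : Metric n M) {x : M}
    (hx : x ∈ φ.source) (v w : TangentSpace (𝓡 n) x) :
    g.chartForm φ (φ x) (mfderiv (𝓡 n) (𝓡 n) φ x v) (mfderiv (𝓡 n) (𝓡 n) φ x w) = g.val x v w := by
  have key : ∀ u ∈ φ.target, ∀ v w, g.chartForm φ u (mfderiv (𝓡 n) (𝓡 n) φ (φ.symm u) v)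
      (mfderiv (𝓡 n) (𝓡 n) φ (φ.symm u) w) = g.val (φ.symm u) v w := fun u hu v w =>
    congrArg₂ (fun v w => g.val (φ.symm u) v w)
      (DFunLike.congr_fun (mfderiv_symm_comp_mfderiv hφ hu) v)
      (DFunLike.congr_fun (mfderiv_symm_comp_mfderiv hφ hu) w)
  have h := key (φ x) (φ.map_source hx)
  rw [φ.left_inv hx] at h
  exact h v w

theorem chartForm_transition (hφ : φ ∈ IsManifold.maximalAtlas (𝓡 n) ∞ M)
    (hψ : ψ ∈ IsManifold.maximalAtlas (𝓡 n) ∞ M) (g : Metric n M) (hu : u ∈ ψ.target)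
    (hu' : ψ.symm u ∈ φ.source) :
    g.chartForm ψ u = (g.chartForm φ (φ (ψ.symm u))).comp
      (fderiv ℝ (φ ∘ ψ.symm) u).toLinearMap (fderiv ℝ (φ ∘ ψ.symm) u).toLinearMap := by
  rw [fderiv_transition hφ hψ hu hu']
  refine LinearMap.BilinForm.ext fun v w => ?_
  exact (chartForm_mfderiv hφ g hu' (mfderiv (𝓡 n) (𝓡 n) ψ.symm u v)
    (mfderiv (𝓡 n) (𝓡 n) ψ.symm u w)).symm

theorem components_transition (hφ : φ ∈ IsManifold.maximalAtlas (𝓡 n) ∞ M)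
    (hψ : ψ ∈ IsManifold.maximalAtlas (𝓡 n) ∞ M) (g : Metric n M) (hu : u ∈ ψ.target)
    (hu' : ψ.symm u ∈ φ.source) :
    g.components ψ u = (jacobian (φ ∘ ψ.symm) u)ᵀ * g.components φ (φ (ψ.symm u)) *
      jacobian (φ ∘ ψ.symm) u := by
  rw [← toMatrix_chartForm, ← toMatrix_chartForm, chartForm_transition hφ hψ g hu hu',
    LinearMap.BilinForm.toMatrix_comp (frame n) (frame n)]
  rfl

theorem contDiffAt_localForm (hφ : φ ∈ IsManifold.maximalAtlas (𝓡 n) ∞ M) (θ : Forms n M)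
    (hu : u ∈ φ.target) : ContDiffAt ℝ ∞ (localForm φ (θ : RoughForm n M)) u :=
  contDiffAt_form_iff.2 fun S => (θ.2 φ hφ S).contDiffAt (φ.open_target.mem_nhds hu)

theorem coordDiv_transition (hφ : φ ∈ IsManifold.maximalAtlas (𝓡 n) ∞ M)
    (hψ : ψ ∈ IsManifold.maximalAtlas (𝓡 n) ∞ M) (g : Metric n M) (θ : Forms n M)
    (hu : u ∈ ψ.target) (hu' : ψ.symm u ∈ φ.source) :
    coordDiv (g.components ψ) (localForm ψ (θ : RoughForm n M)) u =
      coMap (jacobian (φ ∘ ψ.symm) u)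
        (coordDiv (g.components φ) (localForm φ (θ : RoughForm n M)) (φ (ψ.symm u))) := by
  have hmem := eventually_mem_target_and_symm_mem_source hu hu'
  have hlocal : localForm ψ (θ : RoughForm n M) =ᶠ[nhds u] fun v =>
      coMap (jacobian (φ ∘ ψ.symm) v) (localForm φ (θ : RoughForm n M) ((φ ∘ ψ.symm) v)) :=
    hmem.mono fun v hv => localForm_transition hφ hψ _ hv.1 hv.2
  rw [coordDiv_congr hlocal]
  exact coordDiv_pullback (isLocalMetric_components hφ g) (φ.map_source hu')
    (isLocalMetric_components hψ g) hu (contDiffAt_transition hφ hψ hu hu')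
    (hmem.mono fun v hv => components_transition hφ hψ g hv.1 hv.2)
    ((contDiffAt_localForm hφ θ (φ.map_source hu')).differentiableAt (by simp))

/-- The coordinate expression of a form at a point of a chart, as an algebra homomorphism. -/
def localHom (φ : OpenPartialHomeomorph M (EuclideanSpace ℝ (Fin n))) (u : Coord n) :
    Forms n M →ₐ[ℝ] CoordAlg n :=
  ((ExteriorAlgebra.map
    (Module.Dual.transpose (R := ℝ) (M := Coord n) (M' := TangentSpace (𝓡 n) (φ.symm u))
      (mfderiv (𝓡 n) (𝓡 n) φ.symm u).toLinearMap)).comp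
    (Pi.evalAlgHom ℝ (fun x : M => ExteriorAlgebra ℝ (Cotangent n M x)) (φ.symm u))).comp
    (Forms n M).val

theorem localHom_apply (u : Coord n) (θ : Forms n M) :
    localHom φ u θ = localForm φ (θ : RoughForm n M) u :=
  rfl

theorem differentiableAt_localHom (hφ : φ ∈ IsManifold.maximalAtlas (𝓡 n) ∞ M) (θ : Forms n M)
    (hu : u ∈ φ.target) : DifferentiableAt ℝ (fun v => localHom φ v θ) u :=
  (contDiffAt_localForm hφ θ hu).differentiableAt (by simp)

theorem localHom_mem {p : ℕ} {θ : Forms n M} (hθ : θ ∈ formsOfDegree n M p) (u : Coord n) :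
    localHom φ u θ ∈ ⋀[ℝ]^p (Module.Dual ℝ (Coord n)) :=
  map_mem_exteriorPower _ (hθ _)

theorem localHom_ofFun (a : C^∞⟮𝓡 n, M; ℝ⟯) (u : Coord n) :
    localHom φ u (ofFun a) = algebraMap ℝ _ (a (φ.symm u)) :=
  AlgHom.commutes _ _

variable [IsManifold (𝓡 n) ∞ M]

theorem chartAt_mem_maximalAtlas (x : M) :
    chartAt (EuclideanSpace ℝ (Fin n)) x ∈ IsManifold.maximalAtlas (𝓡 n) ∞ M :=
  IsManifold.chart_mem_maximalAtlas x

theorem chartPullback_localHom_chartAt (θ : Forms n M) (x : M) :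
    chartPullback (chartAt (EuclideanSpace ℝ (Fin n)) x) x
      (localHom (chartAt (EuclideanSpace ℝ (Fin n)) x)
        (chartAt (EuclideanSpace ℝ (Fin n)) x x) θ) = (θ : RoughForm n M) x :=
  chartPullback_localForm_apply (chartAt_mem_maximalAtlas x) _ (mem_chart_source _ x)

theorem forms_ext {θ η : Forms n M}
    (h : ∀ φ ∈ IsManifold.maximalAtlas (𝓡 n) ∞ M, ∀ u ∈ φ.target, localHom φ u θ = localHom φ u η) :
    θ = η := by
  refine Subtype.ext (funext fun x => ?_)
  rw [← chartPullback_localHom_chartAt θ x, ← chartPullback_localHom_chartAt η x,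
    h _ (chartAt_mem_maximalAtlas x) _ (mem_chart_target _ x)]

end Charts

/-! ### The codifferential of a metric -/

section Codifferential

variable {n : ℕ} {M : Type*} [TopologicalSpace M] [ChartedSpace (EuclideanSpace ℝ (Fin n)) M]
  {φ : OpenPartialHomeomorph M (EuclideanSpace ℝ (Fin n))}

/-- The divergence of a form, computed at each point in the preferred chart there. -/
def roughDiv (g : Metric n M) (θ : Forms n M) : RoughForm n M := fun x =>
  chartPullback (chartAt (EuclideanSpace ℝ (Fin n)) x) x
    (coordDiv (g.components (chartAt (EuclideanSpace ℝ (Fin n)) x))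
      (localForm (chartAt (EuclideanSpace ℝ (Fin n)) x) (θ : RoughForm n M))
      (chartAt (EuclideanSpace ℝ (Fin n)) x x))

theorem IsCodifferential.localHom_eq {g : Metric n M} {δ : Forms n M →ₗ[ℝ] Forms n M}
    (h : IsCodifferential g δ) (hφ : φ ∈ IsManifold.maximalAtlas (𝓡 n) ∞ M)
    (θ : Forms n M) {u : Coord n} (hu : u ∈ φ.target) :
    localHom φ u (δ θ) = coordDiv (g.components φ) (fun v => localHom φ v θ) u :=
  h φ hφ θ u hu

variable [IsManifold (𝓡 n) ∞ M]

theorem localForm_roughDiv (hφ : φ ∈ IsManifold.maximalAtlas (𝓡 n) ∞ M) (g : Metric n M)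
    (θ : Forms n M) {u : Coord n} (hu : u ∈ φ.target) :
    localForm φ (roughDiv g θ) u =
      coordDiv (g.components φ) (localForm φ (θ : RoughForm n M)) u := by
  have hchart := chartAt_mem_maximalAtlas (n := n) (φ.symm u)
  have hsource := mem_chart_source (EuclideanSpace ℝ (Fin n)) (φ.symm u)
  rw [coordDiv_transition hchart hφ g θ hu hsource]
  exact localForm_chartPullback hchart hφ hu hsource rfl

theorem isSmoothForm_roughDiv (g : Metric n M) (θ : Forms n M) : IsSmoothForm (roughDiv g θ) := by
  intro φ hφ S u hu
  have hdiv : localForm φ (roughDiv g θ) =ᶠ[nhds u]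
      coordDiv (g.components φ) (localForm φ (θ : RoughForm n M)) := by
    filter_upwards [φ.open_target.mem_nhds hu] with v hv
    exact localForm_roughDiv hφ g θ hv
  exact (contDiffAt_form_iff.1 ((contDiffAt_coordDiv (isLocalMetric_components hφ g) hu
    (contDiffAt_localForm hφ θ hu)).congr_of_eventuallyEq hdiv) S).contDiffWithinAt

theorem localHom_roughDiv (hφ : φ ∈ IsManifold.maximalAtlas (𝓡 n) ∞ M) (g : Metric n M)
    (θ : Forms n M) {u : Coord n} (hu : u ∈ φ.target) :
    localHom φ u ⟨roughDiv g θ, isSmoothForm_roughDiv g θ⟩ =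
      coordDiv (g.components φ) (fun v => localHom φ v θ) u :=
  localForm_roughDiv hφ g θ hu

/-- The codifferential of a metric. -/
def codiff (g : Metric n M) : Forms n M →ₗ[ℝ] Forms n M where
  toFun θ := ⟨roughDiv g θ, isSmoothForm_roughDiv g θ⟩
  map_add' θ η := forms_ext fun φ hφ u hu => by
    rw [map_add, localHom_roughDiv hφ g _ hu, localHom_roughDiv hφ g _ hu,
      localHom_roughDiv hφ g _ hu,
      ← coordDiv_add (differentiableAt_localHom hφ θ hu) (differentiableAt_localHom hφ η hu)]
    simp only [map_add]
  map_smul' r θ := forms_ext fun φ hφ u hu => by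
    rw [RingHom.id_apply, map_smul, localHom_roughDiv hφ g _ hu, localHom_roughDiv hφ g _ hu,
      ← coordDiv_const_smul (differentiableAt_localHom hφ θ hu)]
    simp only [map_smul]

theorem isCodifferential_codiff (g : Metric n M) : IsCodifferential g (codiff g) :=
  fun _ hφ θ _ hu => localForm_roughDiv hφ g θ hu

namespace IsCodifferential

variable {g : Metric n M} {δ : Forms n M →ₗ[ℝ] Forms n M}

theorem unique {δ' : Forms n M →ₗ[ℝ] Forms n M} (h : IsCodifferential g δ)
    (h' : IsCodifferential g δ') : δ = δ' :=
  LinearMap.ext fun θ => forms_ext fun φ hφ u hu => by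
    rw [h.localHom_eq hφ θ hu, h'.localHom_eq hφ θ hu]

theorem isBV (h : IsCodifferential g δ) : IsBV δ where
  degree_zero θ hθ := forms_ext fun φ hφ u hu => by
    rw [h.localHom_eq hφ θ hu, map_zero]
    exact coordDiv_eq_zero (differentiableAt_localHom hφ θ hu) (.of_forall (localHom_mem hθ))
  degree_succ k θ hθ x := by
    have hchart := chartAt_mem_maximalAtlas (n := n) x
    have hx := mem_chart_target (EuclideanSpace ℝ (Fin n)) x
    rw [← chartPullback_localHom_chartAt, h.localHom_eq hchart θ hx]
    exact map_mem_exteriorPower _ (coordDiv_mem (differentiableAt_localHom hchart θ hx)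
      (.of_forall (localHom_mem hθ)))
  sq_zero θ := forms_ext fun φ hφ u hu => by
    have hδ : (fun v => localHom φ v (δ θ)) =ᶠ[nhds u]
        coordDiv (g.components φ) (fun v => localHom φ v θ) := by
      filter_upwards [φ.open_target.mem_nhds hu] with v hv
      exact h.localHom_eq hφ θ hv
    rw [h.localHom_eq hφ _ hu, map_zero, coordDiv_congr hδ]
    exact coordDiv_coordDiv (isLocalMetric_components hφ g) hu
      (fun v hv => (contDiffAt_localForm hφ θ hv).contDiffWithinAt)
  seven_term p q θ hθ η hη ζ := forms_ext fun φ hφ u hu => by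
    simp only [map_mul, map_add, map_sub, map_pow, map_neg, map_one, h.localHom_eq hφ _ hu]
    exact coordDiv_seven_term (differentiableAt_localHom hφ θ hu)
      (differentiableAt_localHom hφ η hu) (differentiableAt_localHom hφ ζ hu)
      (.of_forall (localHom_mem hθ)) (.of_forall (localHom_mem hη))

end IsCodifferential

end Codifferential

/-! ### The inverse of a metric -/

section InverseForm

open LinearMap (BilinForm)
open Module (Dual)
open Matrix

variable {K V : Type*} [Field K] [AddCommGroup V] [Module K V] [FiniteDimensional K V]
  {B : BilinForm K V}

/-- The form `(α, β) ↦ B(α♯, β♯)` on the dual space inverse to `B`, where `B(α♯, ·) = α`. -/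
def inverseForm (hB : B.Nondegenerate) : BilinForm K (Dual K V) :=
  B.comp (B.toDual hB).symm.toLinearMap (B.toDual hB).symm.toLinearMap

theorem inverseForm_apply (hB : B.Nondegenerate) (α β : Dual K V) :
    inverseForm hB α β = α ((B.toDual hB).symm β) :=
  BilinForm.apply_toDual_symm_apply α _

theorem inverseForm_toDual (hB : B.Nondegenerate) (v w : V) :
    inverseForm hB (B.toDual hB v) (B.toDual hB w) = B v w := by
  rw [inverseForm_apply, LinearEquiv.symm_apply_apply, BilinForm.toDual_def]

theorem inverseForm_eq_sum {κ : Type*} [Fintype κ] [DecidableEq κ] (hB : B.Nondegenerate)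
    (b : Module.Basis κ K V) (α β : Dual K V) :
    inverseForm hB α β =
      ∑ i, ∑ j, (LinearMap.BilinForm.toMatrix b B)⁻¹ j i * (α (b i) * β (b j)) := by
  set w := (B.toDual hB).symm β with hw
  set G := LinearMap.BilinForm.toMatrix b B with hG
  have hdet : IsUnit G.det := ((BilinForm.nondegenerate_iff_det_ne_zero b).1 hB).isUnit
  have hβ : (fun j => β (b j)) = b.repr w ᵥ* G := by
    funext j
    rw [← BilinForm.apply_toDual_symm_apply (hB := hB) β, ← hw]
    conv_lhs => rw [← b.sum_repr w]
    simp only [map_sum, map_smul, LinearMap.sum_apply, LinearMap.smul_apply, smul_eq_mul, vecMul,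
      dotProduct, hG, LinearMap.BilinForm.toMatrix_apply]
  have hrepr : (fun j => β (b j)) ᵥ* G⁻¹ = b.repr w := by
    rw [hβ, vecMul_vecMul, mul_nonsing_inv _ hdet, vecMul_one]
  rw [inverseForm_apply, ← hw]
  conv_lhs => rw [← b.sum_repr w]
  simp only [map_sum, map_smul, smul_eq_mul, ← hrepr, vecMul, dotProduct, Finset.sum_mul]
  exact Finset.sum_congr rfl fun i _ => Finset.sum_congr rfl fun j _ => by ring

theorem inverseForm_dualBasis {κ : Type*} [Fintype κ] [DecidableEq κ] (hB : B.Nondegenerate)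
    (b : Module.Basis κ K V) (k l : κ) :
    inverseForm hB (b.dualBasis l) (b.dualBasis k) = (LinearMap.BilinForm.toMatrix b B)⁻¹ k l := by
  simp only [inverseForm_eq_sum hB b, Module.Basis.dualBasis_apply_self, mul_ite, mul_one, mul_zero,
    Finset.sum_ite_eq', Finset.mem_univ, if_true]

theorem inverseForm_injective {B' : BilinForm K V} (hB : B.Nondegenerate) (hB' : B'.Nondegenerate)
    (h : inverseForm hB = inverseForm hB') : B = B' := by
  have hsharp : (B.toDual hB).symm = (B'.toDual hB').symm := LinearEquiv.ext fun β => by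
    refine sub_eq_zero.1 ((Module.forall_dual_apply_eq_zero_iff K _).1 fun α => ?_)
    rw [map_sub, ← inverseForm_apply, ← inverseForm_apply, h, sub_self]
  have hflat : B.toDual hB = B'.toDual hB' := by
    rw [← LinearEquiv.symm_symm (B.toDual hB), hsharp, LinearEquiv.symm_symm]
  exact congrArg LinearEquiv.toLinearMap hflat

theorem exists_inverseForm_eq {H : BilinForm K (Dual K V)} (hH : H.Nondegenerate) :
    ∃ (B : BilinForm K V) (hB : B.Nondegenerate), inverseForm hB = H := by
  let sharp : Dual K V ≃ₗ[K] V := (H.flip.toDual hH.flip).trans (Module.evalEquiv K V).symm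
  have apply_sharp (α β : Dual K V) : α (sharp β) = H α β := by
    simp [sharp, BilinForm.toDual_def]
  have hB : BilinForm.Nondegenerate sharp.symm.toLinearMap :=
    .ofSeparatingLeft fun v hv => sharp.symm.map_eq_zero_iff.1 (LinearMap.ext hv)
  have toDual_sharp (β : Dual K V) :
      (BilinForm.toDual sharp.symm.toLinearMap hB).symm β = sharp β :=
    (LinearEquiv.symm_apply_eq _).2 (sharp.symm_apply_apply β).symm
  exact ⟨sharp.symm.toLinearMap, hB, LinearMap.ext₂ fun α β => by
    rw [inverseForm_apply, toDual_sharp, apply_sharp]⟩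

theorem symm_of_inverseForm_symm (hB : B.Nondegenerate)
    (h : ∀ α β, inverseForm hB α β = inverseForm hB β α) (v w : V) : B v w = B w v := by
  rw [← inverseForm_toDual hB, h, inverseForm_toDual]

end InverseForm

namespace Metric

variable {n : ℕ} {M : Type*} [TopologicalSpace M] [ChartedSpace (EuclideanSpace ℝ (Fin n)) M]

theorem inv_eq_inverseForm (g : Metric n M) (x : M) (α β : Cotangent n M x) :
    g.inv x α β = inverseForm (g.nondegenerate x) α β :=
  rfl

theorem inv_symm (g : Metric n M) (x : M) (α β : Cotangent n M x) :
    g.inv x α β = g.inv x β α := g.symm _ _ _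

theorem inv_toDual (g : Metric n M) (x : M) (v w : TangentSpace (𝓡 n) x) :
    g.inv x ((g.val x).toDual (g.nondegenerate x) v) ((g.val x).toDual (g.nondegenerate x) w) =
      g.val x v w :=
  inverseForm_toDual (g.nondegenerate x) v w

theorem eq_zero_of_inv (g : Metric n M) {x : M} {α : Cotangent n M x}
    (h : ∀ β, g.inv x α β = 0) : α = 0 := by
  refine LinearMap.ext fun w => ?_
  have hw := h ((g.val x).toDual (g.nondegenerate x) w)
  rwa [inv_eq_inverseForm, inverseForm_apply, LinearEquiv.symm_apply_apply] at hw

theorem ext_of_inv {g g' : Metric n M} (h : ∀ x α β, g.inv x α β = g'.inv x α β) : g = g' :=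
  Metric.ext <| funext fun x =>
    inverseForm_injective (g.nondegenerate x) (g'.nondegenerate x) (LinearMap.ext₂ (h x))

theorem inv_eq_sum {φ : OpenPartialHomeomorph M (EuclideanSpace ℝ (Fin n))}
    (hφ : φ ∈ IsManifold.maximalAtlas (𝓡 n) ∞ M) (g : Metric n M) {u : Coord n}
    (hu : u ∈ φ.target) (α β : Cotangent n M (φ.symm u)) :
    g.inv (φ.symm u) α β =
      ∑ i, ∑ j, (g.components φ u)⁻¹ i j * (α (chartBasis hφ hu i) * β (chartBasis hφ hu j)) := by
  rw [inv_symm, inv_eq_inverseForm, inverseForm_eq_sum _ (chartBasis hφ hu),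
    ← components_eq_toMatrix hφ, Finset.sum_comm]
  exact Finset.sum_congr rfl fun i _ => Finset.sum_congr rfl fun j _ => by ring

end Metric

/-! ### Functions and forms near a point -/

section LocalToGlobal

variable {n : ℕ} {M : Type*} [TopologicalSpace M] [ChartedSpace (EuclideanSpace ℝ (Fin n)) M]
  {φ : OpenPartialHomeomorph M (EuclideanSpace ℝ (Fin n))} {u : Coord n}

theorem ι_ιInv {θ : Forms n M} (hθ : θ ∈ formsOfDegree n M 1) (x : M) :
    ExteriorAlgebra.ι ℝ (ExteriorAlgebra.ιInv ((θ : RoughForm n M) x)) =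
      (θ : RoughForm n M) x := by
  obtain ⟨α, hα⟩ := exists_ι_of_mem_one (hθ x)
  rw [← hα, ExteriorAlgebra.ι_leftInverse]

theorem ιInv_dFun (a : C^∞⟮𝓡 n, M; ℝ⟯) (x : M) :
    ExteriorAlgebra.ιInv ((dFun a : RoughForm n M) x) = dAt a x :=
  ExteriorAlgebra.ι_leftInverse (R := ℝ) (dAt a x)

theorem dFun_mem (a : C^∞⟮𝓡 n, M; ℝ⟯) : dFun a ∈ formsOfDegree n M 1 :=
  fun x => ι_mem_exteriorPower (dAt a x)

theorem ofFun_mem (a : C^∞⟮𝓡 n, M; ℝ⟯) : ofFun a ∈ formsOfDegree n M 0 :=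
  fun x => algebraMap_mem_exteriorPower (a x)

theorem mul_mem_formsOfDegree {p q : ℕ} {θ η : Forms n M} (hθ : θ ∈ formsOfDegree n M p)
    (hη : η ∈ formsOfDegree n M q) : θ * η ∈ formsOfDegree n M (p + q) :=
  fun x => mul_mem_exteriorPower (hθ x) (hη x)

theorem contDiffAt_comp_symm (hφ : φ ∈ IsManifold.maximalAtlas (𝓡 n) ∞ M)
    (a : C^∞⟮𝓡 n, M; ℝ⟯) (hu : u ∈ φ.target) : ContDiffAt ℝ ∞ (fun v => a (φ.symm v)) u :=
  contMDiffAt_iff_contDiffAt.1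
    (a.contMDiff.contMDiffAt.comp u (contMDiffAt_symm_of_mem_maximalAtlas hφ hu))

theorem dAt_mfderiv (hφ : φ ∈ IsManifold.maximalAtlas (𝓡 n) ∞ M) (a : C^∞⟮𝓡 n, M; ℝ⟯)
    (hu : u ∈ φ.target) (X : Coord n) :
    dAt a (φ.symm u) (mfderiv (𝓡 n) (𝓡 n) φ.symm u X) = fderiv ℝ (fun v => a (φ.symm v)) u X := by
  have hcomp : mfderiv (𝓡 n) 𝓘(ℝ, ℝ) (fun v => a (φ.symm v)) u =
      (mfderiv (𝓡 n) 𝓘(ℝ, ℝ) a (φ.symm u)).comp (mfderiv (𝓡 n) (𝓡 n) φ.symm u) :=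
    mfderiv_comp u (a.contMDiff.mdifferentiable (by simp) _)
      ((mdifferentiable_of_mem_maximalAtlas hφ).mdifferentiableAt_symm hu)
  rw [← mfderiv_eq_fderiv, hcomp]
  rfl

theorem localHom_eq_ι {θ : Forms n M} {α : Cotangent n M (φ.symm u)}
    (h : ExteriorAlgebra.ι ℝ α = (θ : RoughForm n M) (φ.symm u)) :
    localHom φ u θ = ExteriorAlgebra.ι ℝ (Module.Dual.transpose (R := ℝ) (M := Coord n)
      (M' := TangentSpace (𝓡 n) (φ.symm u)) (mfderiv (𝓡 n) (𝓡 n) φ.symm u).toLinearMap α) := by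
  rw [localHom_apply, localForm, ← h, ExteriorAlgebra.map_apply_ι]

theorem algebraMapInv_localHom (η : Forms n M) (u : Coord n) :
    ExteriorAlgebra.algebraMapInv (localHom φ u η) =
      ExteriorAlgebra.algebraMapInv ((η : RoughForm n M) (φ.symm u)) :=
  algebraMapInv_map _ _

theorem eventually_eq_of_localHom (hφ : φ ∈ IsManifold.maximalAtlas (𝓡 n) ∞ M)
    (hu : u ∈ φ.target) {θ η : Forms n M}
    (h : ∀ᶠ v in nhds u, localHom φ v θ = localHom φ v η) :
    ∀ᶠ y in nhds (φ.symm u), (θ : RoughForm n M) y = (η : RoughForm n M) y := by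
  have hφu : Filter.Tendsto φ (nhds (φ.symm u)) (nhds u) := by
    simpa only [ContinuousAt, φ.right_inv hu] using φ.continuousAt (φ.map_target hu)
  filter_upwards [hφu.eventually h, φ.open_source.eventually_mem (φ.map_target hu)] with y hy hys
  rw [← chartPullback_localForm_apply hφ θ hys, ← chartPullback_localForm_apply hφ η hys]
  exact congrArg (chartPullback φ y) hy

variable [IsManifold (𝓡 n) ∞ M]

theorem exists_maximalAtlas_symm_eq (x : M) :
    ∃ φ ∈ IsManifold.maximalAtlas (𝓡 n) ∞ M, ∃ u ∈ φ.target, φ.symm u = x :=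
  ⟨chartAt (EuclideanSpace ℝ (Fin n)) x, chartAt_mem_maximalAtlas x, _, mem_chart_target _ x,
    (chartAt (EuclideanSpace ℝ (Fin n)) x).left_inv (mem_chart_source _ x)⟩

variable [T2Space M]

theorem exists_smooth_cutoff {U : Set M} {x : M} (hU : U ∈ nhds x) :
    ∃ χ : C^∞⟮𝓡 n, M; ℝ⟯, tsupport χ ⊆ U ∧ (χ : M → ℝ) =ᶠ[nhds x] 1 := by
  obtain ⟨χ, -, hχ⟩ := (SmoothBumpFunction.nhds_basis_tsupport (I := 𝓡 n) x).mem_iff.1 hU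
  exact ⟨⟨χ, χ.contMDiff⟩, hχ, χ.eventuallyEq_one⟩

theorem exists_smooth_eventuallyEq {U : Set M} (hU : IsOpen U) {x : M} (hx : x ∈ U) {f : M → ℝ}
    (hf : ContMDiffOn (𝓡 n) 𝓘(ℝ, ℝ) ∞ f U) : ∃ a : C^∞⟮𝓡 n, M; ℝ⟯, (a : M → ℝ) =ᶠ[nhds x] f := by
  obtain ⟨χ, hχ, hχ_one⟩ := exists_smooth_cutoff (n := n) (hU.mem_nhds hx)
  refine ⟨⟨fun y => χ y * f y, contMDiff_of_tsupport fun y hy => ?_⟩, ?_⟩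
  · have hyU : y ∈ U := hχ (closure_mono (Function.support_mul_subset_left _ _) hy)
    exact χ.contMDiff.contMDiffAt.mul (hf.contMDiffAt (hU.mem_nhds hyU))
  · filter_upwards [hχ_one] with y hy
    change χ y * f y = f y
    rw [hy, Pi.one_apply, one_mul]

theorem exists_smooth_eventually_comp_symm_eq (hφ : φ ∈ IsManifold.maximalAtlas (𝓡 n) ∞ M)
    (hu : u ∈ φ.target) {f : Coord n → ℝ} (hf : ContDiffOn ℝ ∞ f φ.target) :
    ∃ a : C^∞⟮𝓡 n, M; ℝ⟯, (fun v => a (φ.symm v)) =ᶠ[nhds u] f := by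
  have hfφ : ContMDiffOn (𝓡 n) 𝓘(ℝ, ℝ) ∞ (fun y => f (φ y)) φ.source :=
    (contMDiffOn_iff_contDiffOn.2 hf).comp (contMDiffOn_of_mem_maximalAtlas hφ) φ.mapsTo
  obtain ⟨a, ha⟩ := exists_smooth_eventuallyEq φ.open_source (φ.map_target hu) hfφ
  refine ⟨a, ?_⟩
  filter_upwards [(φ.continuousAt_symm hu).eventually ha, φ.open_target.mem_nhds hu] with v hv hvt
  rw [hv, φ.right_inv hvt]

theorem exists_eventually_dAt_mfderiv_eq (hφ : φ ∈ IsManifold.maximalAtlas (𝓡 n) ∞ M)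
    (hu : u ∈ φ.target) (α : Module.Dual ℝ (Coord n)) :
    ∃ a : C^∞⟮𝓡 n, M; ℝ⟯, ∀ᶠ v in nhds u, ∀ X : Coord n,
      dAt a (φ.symm v) (mfderiv (𝓡 n) (𝓡 n) φ.symm v X) = α X := by
  obtain ⟨a, ha⟩ :=
    exists_smooth_eventually_comp_symm_eq hφ hu α.toContinuousLinearMap.contDiff.contDiffOn
  refine ⟨a, ?_⟩
  filter_upwards [ha.eventuallyEq_nhds, φ.open_target.mem_nhds hu] with v hv hvt X
  refine (dAt_mfderiv hφ a hvt X).trans ?_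
  rw [hv.fderiv_eq, ContinuousLinearMap.fderiv]
  rfl

theorem exists_dAt_eq (x : M) (α : Cotangent n M x) : ∃ a : C^∞⟮𝓡 n, M; ℝ⟯, dAt a x = α := by
  obtain ⟨φ, hφ, u, hu, rfl⟩ := exists_maximalAtlas_symm_eq (n := n) x
  obtain ⟨a, ha⟩ := exists_eventually_dAt_mfderiv_eq hφ hu (Module.Dual.transpose (R := ℝ)
    (M := Coord n) (M' := TangentSpace (𝓡 n) (φ.symm u))
    (mfderiv (𝓡 n) (𝓡 n) φ.symm u).toLinearMap α)
  exact ⟨a, (chartBasis hφ hu).ext fun i => ha.self_of_nhds (frame n i)⟩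

/-- The coefficient of `dxⁱ` in a form, extracted as the degree `0` part of `ι_{∂ᵢ}`. -/
def coframeCoeff (i : Fin n) : CoordAlg n →ₗ[ℝ] ℝ :=
  ExteriorAlgebra.algebraMapInv.toLinearMap ∘ₗ intProd i

theorem coframeCoeff_ι (i : Fin n) (α : Module.Dual ℝ (Coord n)) :
    coframeCoeff i (ExteriorAlgebra.ι ℝ α) = α (frame n i) := by
  rw [coframeCoeff, LinearMap.comp_apply, intProd, contractLeft_ι]
  exact ExteriorAlgebra.algebraMap_leftInverse _ _

theorem sum_coframeCoeff_smul {c : CoordAlg n} (hc : c ∈ ⋀[ℝ]^1 (Module.Dual ℝ (Coord n))) :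
    ∑ i, coframeCoeff i c • ExteriorAlgebra.ι ℝ (coframe n i) = c := by
  obtain ⟨α, rfl⟩ := exists_ι_of_mem_one hc
  simp only [coframeCoeff_ι, ← map_smul, ← map_sum, sum_apply_frame_smul_coframe]

theorem exists_eventually_localHom_dFun_eq (hφ : φ ∈ IsManifold.maximalAtlas (𝓡 n) ∞ M)
    (hu : u ∈ φ.target) (i : Fin n) : ∃ b : C^∞⟮𝓡 n, M; ℝ⟯,
      ∀ᶠ v in nhds u, localHom φ v (dFun b) = ExteriorAlgebra.ι ℝ (coframe n i) := by
  obtain ⟨b, hb⟩ := exists_eventually_dAt_mfderiv_eq hφ hu (coframe n i)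
  refine ⟨b, hb.mono fun v hv => ?_⟩
  rw [localHom_eq_ι (α := dAt b (φ.symm v)) rfl]
  exact congrArg (ExteriorAlgebra.ι ℝ) (LinearMap.ext hv)

theorem exists_local_expansion {θ : Forms n M} (hθ : θ ∈ formsOfDegree n M 1) (x : M) :
    ∃ c b : Fin n → C^∞⟮𝓡 n, M; ℝ⟯, (∀ᶠ y in nhds x, (θ : RoughForm n M) y =
      ((∑ i, ofFun (c i) * dFun (b i) : Forms n M) : RoughForm n M) y) ∧
      ((θ : RoughForm n M) x = 0 → ∀ i, c i x = 0) := by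
  obtain ⟨φ, hφ, u, hu, rfl⟩ := exists_maximalAtlas_symm_eq (n := n) x
  choose b hb using exists_eventually_localHom_dFun_eq hφ hu
  choose c hc using fun i => exists_smooth_eventually_comp_symm_eq hφ hu fun v hv =>
    (contDiffAt_linearMap_comp (coframeCoeff i)
      (contDiffAt_localForm hφ θ hv)).contDiffWithinAt
  refine ⟨c, b, eventually_eq_of_localHom hφ hu ?_, fun hx i => ?_⟩
  · filter_upwards [Filter.eventually_all.2 hb, Filter.eventually_all.2 hc] with v hbv hcv
    simp only [map_sum, map_mul, hbv, localHom_ofFun, hcv, ← Algebra.smul_def]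
    exact (sum_coframeCoeff_smul (localHom_mem hθ v)).symm
  · rw [(hc i).eq_of_nhds, localForm, hx, map_zero, map_zero]

end LocalToGlobal

/-! ### The associated bilinear form -/

section Pairing

variable {n : ℕ} {M : Type*} [TopologicalSpace M] [ChartedSpace (EuclideanSpace ℝ (Fin n)) M]
  {δ : Forms n M →ₗ[ℝ] Forms n M} {g : Metric n M}

/-- The associated form at a point as a linear map of its first argument. -/
def pairingLin (δ : Forms n M →ₗ[ℝ] Forms n M) (a : C^∞⟮𝓡 n, M; ℝ⟯) (x : M) :
    Forms n M →ₗ[ℝ] ℝ :=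
  ExteriorAlgebra.algebraMapInv.toLinearMap ∘ₗ
    (Pi.evalAlgHom ℝ (fun x : M => ExteriorAlgebra ℝ (Cotangent n M x)) x).toLinearMap ∘ₗ
    (Forms n M).val.toLinearMap ∘ₗ
    (δ ∘ₗ LinearMap.mulLeft ℝ (ofFun a) - LinearMap.mulLeft ℝ (ofFun a) ∘ₗ δ)

theorem pairingLin_apply (a : C^∞⟮𝓡 n, M; ℝ⟯) (x : M) (θ : Forms n M) :
    pairingLin δ a x θ = pairing δ θ a x :=
  rfl

theorem pairing_symm (hs : IsSymmetricOp δ) (a b : C^∞⟮𝓡 n, M; ℝ⟯) (x : M) :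
    pairing δ (dFun b) a x = pairing δ (dFun a) b x := by
  rw [pairing, pairing, hs]

theorem ofFun_mul_comm (a : C^∞⟮𝓡 n, M; ℝ⟯) (θ : Forms n M) : ofFun a * θ = θ * ofFun a :=
  Subtype.ext <| funext fun x =>
    Algebra.commutes (A := ExteriorAlgebra ℝ (Cotangent n M x)) (a x) ((θ : RoughForm n M) x)

theorem map_mul_mul_sub_of_seven_term {R : Type*} [Ring R] {δ : R → R} {a b z : R}
    (hab : Commute a b) (ha : δ a = 0) (hb : δ b = 0) (hδab : δ (a * b) = 0)
    (h : δ (a * b * z) = δ (a * b) * z + (-1) ^ 0 * (a * δ (b * z)) +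
      (-1) ^ ((0 + 1) * 0) * (b * δ (a * z)) - δ a * b * z - (-1) ^ 0 * (a * δ b * z) -
      (-1) ^ (0 + 0) * (a * b * δ z)) :
    δ (a * (b * z)) - a * δ (b * z) = b * (δ (a * z) - a * δ z) := by
  rw [← mul_assoc, h, ha, hb, hδab, hab.eq]
  simp only [Nat.mul_zero, Nat.add_zero, pow_zero]
  noncomm_ring

theorem IsBV.map_ofFun_mul_sub (h : IsBV δ) (a b : C^∞⟮𝓡 n, M; ℝ⟯) (θ : Forms n M) :
    δ (ofFun a * (ofFun b * θ)) - ofFun a * δ (ofFun b * θ) =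
      ofFun b * (δ (ofFun a * θ) - ofFun a * δ θ) :=
  have hab : ofFun a * ofFun b ∈ formsOfDegree n M (0 + 0) :=
    mul_mem_formsOfDegree (ofFun_mem a) (ofFun_mem b)
  map_mul_mul_sub_of_seven_term (ofFun_mul_comm a _) (h.degree_zero _ (ofFun_mem a))
    (h.degree_zero _ (ofFun_mem b)) (h.degree_zero _ hab)
    (h.seven_term 0 0 _ (ofFun_mem a) _ (ofFun_mem b) θ)

theorem pairing_ofFun_mul (h : IsBV δ) (b : C^∞⟮𝓡 n, M; ℝ⟯) (θ : Forms n M)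
    (a : C^∞⟮𝓡 n, M; ℝ⟯) (x : M) : pairing δ (ofFun b * θ) a x = b x * pairing δ θ a x := by
  rw [pairing, h.map_ofFun_mul_sub]
  exact (map_mul ExteriorAlgebra.algebraMapInv _ _).trans
    (congrArg (· * pairing δ θ a x)
      (ExteriorAlgebra.algebraMap_leftInverse (Cotangent n M x) (b x)))

theorem IsInverseMetricOf.pairing_dFun (h : IsInverseMetricOf δ g) (a b : C^∞⟮𝓡 n, M; ℝ⟯) (x : M) :
    pairing δ (dFun b) a x = g.inv x (dAt b x) (dAt a x) :=
  (h _ (dFun_mem b) a x).trans (congrArg (g.inv x · (dAt a x)) (ιInv_dFun b x))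

theorem IsBV.ofFun_mul_sub_mem (h : IsBV δ) {θ : Forms n M} (hθ : θ ∈ formsOfDegree n M 1)
    (a : C^∞⟮𝓡 n, M; ℝ⟯) : δ (ofFun a * θ) - ofFun a * δ θ ∈ formsOfDegree n M 0 :=
  Submodule.sub_mem _ (h.degree_succ 0 _ (mul_mem_formsOfDegree (ofFun_mem a) hθ))
    (mul_mem_formsOfDegree (ofFun_mem a) (h.degree_succ 0 _ hθ))

theorem eq_of_algebraMapInv_eq {θ η : Forms n M} (hθ : θ ∈ formsOfDegree n M 0)
    (hη : η ∈ formsOfDegree n M 0)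
    (h : ∀ x, ExteriorAlgebra.algebraMapInv ((θ : RoughForm n M) x) =
      ExteriorAlgebra.algebraMapInv ((η : RoughForm n M) x)) : θ = η := by
  refine Subtype.ext (funext fun x => ?_)
  obtain ⟨r, hr⟩ := exists_algebraMap_of_mem_zero (hθ x)
  obtain ⟨s, hs⟩ := exists_algebraMap_of_mem_zero (hη x)
  have hx := h x
  rw [← hr, ← hs, ExteriorAlgebra.algebraMap_leftInverse,
    ExteriorAlgebra.algebraMap_leftInverse] at hx
  rw [← hr, ← hs, hx]

theorem IsInverseMetricOf.isSymmetricOp (h : IsInverseMetricOf δ g) (hδ : IsBV δ) :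
    IsSymmetricOp δ := fun a b =>
  eq_of_algebraMapInv_eq (hδ.ofFun_mul_sub_mem (dFun_mem b) a)
    (hδ.ofFun_mul_sub_mem (dFun_mem a) b) fun x => by
      change pairing δ (dFun b) a x = pairing δ (dFun a) b x
      rw [h.pairing_dFun, h.pairing_dFun, g.inv_symm]

theorem IsCodifferential.localHom_map_ofFun_mul_sub (h : IsCodifferential g δ)
    {φ : OpenPartialHomeomorph M (EuclideanSpace ℝ (Fin n))}
    (hφ : φ ∈ IsManifold.maximalAtlas (𝓡 n) ∞ M) {u : Coord n} (hu : u ∈ φ.target)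
    (a : C^∞⟮𝓡 n, M; ℝ⟯) (θ : Forms n M) :
    localHom φ u (δ (ofFun a * θ) - ofFun a * δ θ) =
      ∑ i, ∑ j, ((g.components φ u)⁻¹ i j * pderiv j (fun v => a (φ.symm v)) u) •
        intProd i (localHom φ u θ) := by
  have ha : DifferentiableAt ℝ (fun v => a (φ.symm v)) u :=
    (contDiffAt_comp_symm hφ a hu).differentiableAt (by simp)
  rw [map_sub, map_mul (localHom φ u), h.localHom_eq hφ _ hu, h.localHom_eq hφ _ hu]
  simp only [map_mul (localHom φ _), localHom_ofFun, ← Algebra.smul_def]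
  rw [coordDiv_smul (differentiableAt_localHom hφ θ hu) ha, add_sub_cancel_left]

variable [IsManifold (𝓡 n) ∞ M]

theorem IsCodifferential.isInverseMetricOf (h : IsCodifferential g δ) : IsInverseMetricOf δ g := by
  intro θ hθ a x
  obtain ⟨φ, hφ, u, hu, rfl⟩ := exists_maximalAtlas_symm_eq (n := n) x
  rw [pairing, ← algebraMapInv_localHom, h.localHom_map_ofFun_mul_sub hφ hu,
    localHom_eq_ι (ι_ιInv hθ _), g.inv_eq_sum hφ hu]
  simp only [map_sum, map_smul, smul_eq_mul]
  refine Finset.sum_congr rfl fun i _ => Finset.sum_congr rfl fun j _ => ?_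
  have hcoeff := coframeCoeff_ι i (Module.Dual.transpose (R := ℝ) (M := Coord n)
    (M' := TangentSpace (𝓡 n) (φ.symm u)) (mfderiv (𝓡 n) (𝓡 n) φ.symm u).toLinearMap
    (ExteriorAlgebra.ιInv ((θ : RoughForm n M) (φ.symm u))))
  rw [mul_assoc, mul_comm (pderiv _ _ _)]
  exact congrArg ((g.components φ u)⁻¹ i j * ·)
    (congrArg₂ (· * ·) hcoeff (dAt_mfderiv hφ a hu (frame n j)).symm)

variable [T2Space M]

theorem IsInverseMetricOf.pairingNondegenerate (h : IsInverseMetricOf δ g) :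
    PairingNondegenerate δ := by
  intro x θ hθ hpair
  have hzero : (ExteriorAlgebra.ιInv ((θ : RoughForm n M) x) : Cotangent n M x) = 0 :=
    g.eq_zero_of_inv fun β => by
      obtain ⟨a, rfl⟩ := exists_dAt_eq x β
      rw [← h θ hθ a x, hpair]
  rw [← ι_ιInv hθ x, hzero, map_zero]

theorem IsInverseMetricOf.posDef_iff (h : IsInverseMetricOf δ g) :
    g.PosDef ↔ PairingPosDef δ := by
  refine ⟨fun hg x a ha => ?_, fun hδ x v hv => ?_⟩
  · rw [h.pairing_dFun]
    exact hg x _ ((LinearEquiv.map_ne_zero_iff _).2 ha)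
  · obtain ⟨a, ha⟩ := exists_dAt_eq x ((g.val x).toDual (g.nondegenerate x) v)
    have hpos := hδ x a (ha ▸ (LinearEquiv.map_ne_zero_iff _).2 hv)
    rwa [h.pairing_dFun, ha, g.inv_toDual] at hpos

theorem IsInverseMetricOf.unique {g' : Metric n M} (h : IsInverseMetricOf δ g)
    (h' : IsInverseMetricOf δ g') : g = g' := by
  refine Metric.ext_of_inv fun x α β => ?_
  obtain ⟨a, rfl⟩ := exists_dAt_eq x α
  obtain ⟨b, rfl⟩ := exists_dAt_eq x β
  rw [← h.pairing_dFun, ← h'.pairing_dFun]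

theorem IsBV.pairing_congr_of_eventually (h : IsBV δ) {θ η : Forms n M} {x : M}
    (hθη : ∀ᶠ y in nhds x, (θ : RoughForm n M) y = (η : RoughForm n M) y)
    (a : C^∞⟮𝓡 n, M; ℝ⟯) : pairing δ θ a x = pairing δ η a x := by
  obtain ⟨χ, hχ, hχ_one⟩ := exists_smooth_cutoff (n := n) hθη
  have hcut : ofFun χ * θ = ofFun χ * η := by
    refine Subtype.ext (funext fun y => ?_)
    change algebraMap ℝ _ (χ y) * (θ : RoughForm n M) y =
      algebraMap ℝ _ (χ y) * (η : RoughForm n M) y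
    by_cases hy : y ∈ tsupport χ
    · rw [hχ hy]
    · rw [image_eq_zero_of_notMem_tsupport hy, map_zero, zero_mul, zero_mul]
  have hx : χ x = 1 := hχ_one.eq_of_nhds
  have hpair := congrArg (pairing δ · a x) hcut
  simpa only [pairing_ofFun_mul h, hx, one_mul] using hpair

theorem IsBV.pairing_eq_zero (h : IsBV δ) {θ : Forms n M} (hθ : θ ∈ formsOfDegree n M 1) {x : M}
    (hx : (θ : RoughForm n M) x = 0) (a : C^∞⟮𝓡 n, M; ℝ⟯) : pairing δ θ a x = 0 := by
  obtain ⟨c, b, hθ_eq, hc⟩ := exists_local_expansion hθ x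
  rw [h.pairing_congr_of_eventually hθ_eq, ← pairingLin_apply, map_sum]
  refine Finset.sum_eq_zero fun i _ => ?_
  rw [pairingLin_apply, pairing_ofFun_mul h, hc hx, zero_mul]

theorem IsBV.pairing_congr (h : IsBV δ) {θ η : Forms n M} (hθ : θ ∈ formsOfDegree n M 1)
    (hη : η ∈ formsOfDegree n M 1) {x : M} (hx : (θ : RoughForm n M) x = (η : RoughForm n M) x)
    (a : C^∞⟮𝓡 n, M; ℝ⟯) : pairing δ θ a x = pairing δ η a x := by
  have hsub := h.pairing_eq_zero (Submodule.sub_mem _ hθ hη) (sub_eq_zero.2 hx) a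
  rwa [← pairingLin_apply, map_sub, pairingLin_apply, pairingLin_apply, sub_eq_zero] at hsub

end Pairing

/-! ### The metric of a BV structure -/

section MetricOfBV

variable {n : ℕ} {M : Type*} [TopologicalSpace M] [ChartedSpace (EuclideanSpace ℝ (Fin n)) M]
  {δ : Forms n M →ₗ[ℝ] Forms n M}

theorem contDiffAt_pairing {φ : OpenPartialHomeomorph M (EuclideanSpace ℝ (Fin n))}
    (hφ : φ ∈ IsManifold.maximalAtlas (𝓡 n) ∞ M) {u : Coord n} (hu : u ∈ φ.target)
    (θ : Forms n M) (a : C^∞⟮𝓡 n, M; ℝ⟯) :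
    ContDiffAt ℝ ∞ (fun v => pairing δ θ a (φ.symm v)) u := by
  simp only [pairing, ← algebraMapInv_localHom]
  exact contDiffAt_linearMap_comp (ExteriorAlgebra.algebraMapInv.toLinearMap : CoordAlg n →ₗ[ℝ] ℝ)
    (contDiffAt_localForm hφ (δ (ofFun a * θ) - ofFun a * δ θ) hu)

variable [IsManifold (𝓡 n) ∞ M] [T2Space M]

theorem pairing_dFun_congr (h : IsBV δ) (hs : IsSymmetricOp δ) {a a' b b' : C^∞⟮𝓡 n, M; ℝ⟯} {x : M}
    (ha : dAt a x = dAt a' x) (hb : dAt b x = dAt b' x) :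
    pairing δ (dFun a) b x = pairing δ (dFun a') b' x := by
  have congr_left (b : C^∞⟮𝓡 n, M; ℝ⟯) {a a' : C^∞⟮𝓡 n, M; ℝ⟯} (ha : dAt a x = dAt a' x) :
      pairing δ (dFun a) b x = pairing δ (dFun a') b x :=
    h.pairing_congr (dFun_mem _) (dFun_mem _) (congrArg (ExteriorAlgebra.ι ℝ) ha) b
  rw [congr_left b ha, pairing_symm hs, congr_left a' hb, pairing_symm hs]

theorem pairing_dFun_add (h : IsBV δ) {a b c : C^∞⟮𝓡 n, M; ℝ⟯} {x : M}
    (hc : dAt c x = dAt a x + dAt b x) (f : C^∞⟮𝓡 n, M; ℝ⟯) :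
    pairing δ (dFun c) f x = pairing δ (dFun a) f x + pairing δ (dFun b) f x := by
  have hι : (dFun c : RoughForm n M) x = ((dFun a + dFun b : Forms n M) : RoughForm n M) x :=
    (congrArg (ExteriorAlgebra.ι ℝ) hc).trans (map_add _ _ _)
  rw [h.pairing_congr (dFun_mem c) (Submodule.add_mem _ (dFun_mem a) (dFun_mem b)) hι,
    ← pairingLin_apply, map_add, pairingLin_apply, pairingLin_apply]

theorem pairing_dFun_smul (h : IsBV δ) {a c : C^∞⟮𝓡 n, M; ℝ⟯} {x : M} {r : ℝ}
    (hc : dAt c x = r • dAt a x) (f : C^∞⟮𝓡 n, M; ℝ⟯) :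
    pairing δ (dFun c) f x = r • pairing δ (dFun a) f x := by
  have hι : (dFun c : RoughForm n M) x = ((r • dFun a : Forms n M) : RoughForm n M) x :=
    (congrArg (ExteriorAlgebra.ι ℝ) hc).trans (map_smul _ _ _)
  rw [h.pairing_congr (dFun_mem c) (Submodule.smul_mem _ r (dFun_mem a)) hι,
    ← pairingLin_apply, map_smul, pairingLin_apply]

/-- A smooth function with prescribed differential at a point. -/
def primitive (x : M) (α : Cotangent n M x) : C^∞⟮𝓡 n, M; ℝ⟯ :=
  (exists_dAt_eq x α).choose

theorem dAt_primitive (x : M) (α : Cotangent n M x) : dAt (primitive x α) x = α :=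
  (exists_dAt_eq x α).choose_spec

/-- The associated form of a symmetric BV structure as a bilinear form on the cotangent space. -/
def covectorForm (h : IsBV δ) (hs : IsSymmetricOp δ) (x : M) :
    LinearMap.BilinForm ℝ (Cotangent n M x) :=
  have add_left (α α' β : Cotangent n M x) := pairing_dFun_add h
    (a := primitive x α) (b := primitive x α') (c := primitive x (α + α'))
    (by simp only [dAt_primitive]) (primitive x β)
  have smul_left (r : ℝ) (α β : Cotangent n M x) := pairing_dFun_smul h
    (a := primitive x α) (c := primitive x (r • α)) (by simp only [dAt_primitive]) (primitive x β)
  LinearMap.mk₂ ℝ (fun α β => pairing δ (dFun (primitive x α)) (primitive x β) x)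
    add_left smul_left
    (fun α β β' => by simp only [pairing_symm hs _ (primitive x α), add_left])
    (fun r α β => by simp only [pairing_symm hs _ (primitive x α), smul_left])

theorem covectorForm_symm (h : IsBV δ) (hs : IsSymmetricOp δ) (x : M) (α β : Cotangent n M x) :
    covectorForm h hs x α β = covectorForm h hs x β α :=
  pairing_symm hs _ _ _

theorem covectorForm_dAt (h : IsBV δ) (hs : IsSymmetricOp δ) (a b : C^∞⟮𝓡 n, M; ℝ⟯) (x : M) :
    covectorForm h hs x (dAt a x) (dAt b x) = pairing δ (dFun a) b x :=
  pairing_dFun_congr h hs (dAt_primitive x _) (dAt_primitive x _)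

theorem covectorForm_ιInv (h : IsBV δ) (hs : IsSymmetricOp δ) {θ : Forms n M}
    (hθ : θ ∈ formsOfDegree n M 1) (a : C^∞⟮𝓡 n, M; ℝ⟯) (x : M) :
    covectorForm h hs x (ExteriorAlgebra.ιInv ((θ : RoughForm n M) x)) (dAt a x) =
      pairing δ θ a x := by
  obtain ⟨b, hb⟩ := exists_dAt_eq x (ExteriorAlgebra.ιInv ((θ : RoughForm n M) x))
  rw [← hb, covectorForm_dAt]
  refine h.pairing_congr (dFun_mem b) hθ ?_ a
  exact (congrArg (ExteriorAlgebra.ι ℝ) hb).trans (ι_ιInv hθ x)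

theorem covectorForm_nondegenerate (h : IsBV δ) (hs : IsSymmetricOp δ)
    (hn : PairingNondegenerate δ) (x : M) : (covectorForm h hs x).Nondegenerate := by
  refine .ofSeparatingLeft fun α hα => ?_
  obtain ⟨b, rfl⟩ := exists_dAt_eq x α
  have hb : (dFun b : RoughForm n M) x = 0 := hn x (dFun b) (dFun_mem b) fun a => by
    rw [← covectorForm_dAt h hs, hα]
  exact (ExteriorAlgebra.ι_eq_zero_iff _).1 hb

theorem exists_eventually_dAt_eq_dualBasis
    {φ : OpenPartialHomeomorph M (EuclideanSpace ℝ (Fin n))}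
    (hφ : φ ∈ IsManifold.maximalAtlas (𝓡 n) ∞ M) {u : Coord n} (hu : u ∈ φ.target) :
    ∃ b : Fin n → C^∞⟮𝓡 n, M; ℝ⟯, ∀ᶠ v in nhds u, ∃ hv : v ∈ φ.target, ∀ i,
      dAt (b i) (φ.symm v) = (chartBasis hφ hv).dualBasis i := by
  choose b hb using fun i => exists_eventually_dAt_mfderiv_eq hφ hu (coframe n i)
  refine ⟨b, ?_⟩
  filter_upwards [Filter.eventually_all.2 hb, φ.open_target.mem_nhds hu] with v hbv hv
  refine ⟨hv, fun i => (chartBasis hφ hv).ext fun k => ?_⟩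
  exact (hbv i (frame n k)).trans (((frame n).dualBasis_apply_self i k).trans
    ((chartBasis hφ hv).dualBasis_apply_self i k).symm)

theorem contDiffAt_of_inverseForm_eq_pairing
    {B : ∀ x : M, LinearMap.BilinForm ℝ (TangentSpace (𝓡 n) x)} (hB : ∀ x, (B x).Nondegenerate)
    (h : ∀ x a b, inverseForm (hB x) (dAt a x) (dAt b x) = pairing δ (dFun a) b x)
    {φ : OpenPartialHomeomorph M (EuclideanSpace ℝ (Fin n))}
    (hφ : φ ∈ IsManifold.maximalAtlas (𝓡 n) ∞ M) {u : Coord n} (hu : u ∈ φ.target) (i j : Fin n) :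
    ContDiffAt ℝ ∞ (fun v : Coord n => B (φ.symm v)
      (mfderiv (𝓡 n) (𝓡 n) φ.symm v (frame n i))
      (mfderiv (𝓡 n) (𝓡 n) φ.symm v (frame n j))) u := by
  obtain ⟨b, hb⟩ := exists_eventually_dAt_eq_dualBasis hφ hu
  let K : Coord n → Matrix (Fin n) (Fin n) ℝ := fun v =>
    Matrix.of fun k l => pairing δ (dFun (b l)) (b k) (φ.symm v)
  have toMatrix_mul_K {v : Coord n} (hv : v ∈ φ.target)
      (hbv : ∀ i, dAt (b i) (φ.symm v) = (chartBasis hφ hv).dualBasis i) :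
      LinearMap.BilinForm.toMatrix (chartBasis hφ hv) (B (φ.symm v)) * K v = 1 := by
    have hK : K v = (LinearMap.BilinForm.toMatrix (chartBasis hφ hv) (B (φ.symm v)))⁻¹ :=
      Matrix.ext fun k l => (h _ (b l) (b k)).symm.trans <| by
        rw [hbv, hbv, inverseForm_dualBasis]
    rw [hK, Matrix.mul_nonsing_inv]
    exact ((LinearMap.BilinForm.nondegenerate_iff_det_ne_zero _).1 (hB _)).isUnit
  have hK_unit : IsUnit (K u).det := by
    obtain ⟨hu, hbu⟩ := hb.self_of_nhds
    exact Matrix.isUnit_det_of_left_inverse (toMatrix_mul_K hu hbu)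
  have hK_smooth : ContDiffAt ℝ ∞ (fun v => (K v)⁻¹) u :=
    contDiffAt_matrix_inv (contDiffAt_matrix_iff.2 fun k l => contDiffAt_pairing hφ hu _ _) hK_unit
  refine (contDiffAt_matrix_iff.1 hK_smooth i j).congr_of_eventuallyEq ?_
  filter_upwards [hb] with v ⟨hv, hbv⟩
  rw [Matrix.inv_eq_left_inv (toMatrix_mul_K hv hbv), LinearMap.BilinForm.toMatrix_apply]
  rfl

theorem IsBV.exists_isInverseMetricOf (h : IsBV δ) (hs : IsSymmetricOp δ)
    (hn : PairingNondegenerate δ) : ∃ g : Metric n M, IsInverseMetricOf δ g := by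
  choose B hB hBinv using fun x => exists_inverseForm_eq (covectorForm_nondegenerate h hs hn x)
  have symm (x : M) (v w : TangentSpace (𝓡 n) x) : B x v w = B x w v :=
    symm_of_inverseForm_symm (hB x) (fun α β => by rw [hBinv, covectorForm_symm]) v w
  have smooth {φ : OpenPartialHomeomorph M (EuclideanSpace ℝ (Fin n))}
      (hφ : φ ∈ IsManifold.maximalAtlas (𝓡 n) ∞ M) {u : Coord n} (hu : u ∈ φ.target) :=
    contDiffAt_of_inverseForm_eq_pairing hB
      (fun x a b => by rw [hBinv, covectorForm_dAt h hs]) hφ hu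
  let g : Metric n M := ⟨B, symm, hB, fun φ hφ i j u hu => (smooth hφ hu i j).contDiffWithinAt⟩
  refine ⟨g, fun θ hθ a x => ?_⟩
  rw [g.inv_eq_inverseForm, hBinv, covectorForm_ιInv h hs hθ]

end MetricOfBV

end BVGeom
end

open BVGeom in
theorem mainTheorem5_general (n : ℕ) (M : Type*) [TopologicalSpace M]
    [ChartedSpace (EuclideanSpace ℝ (Fin n)) M] [IsManifold (𝓡 n) ∞ M]
    [T2Space M] :
    (Nonempty (Metric n M) ↔
      ∃ δ : Forms n M →ₗ[ℝ] Forms n M, IsBV δ ∧ IsSymmetricOp δ ∧ PairingNondegenerate δ) ∧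
    ((∃ g : Metric n M, g.PosDef) ↔
      ∃ δ : Forms n M →ₗ[ℝ] Forms n M,
        IsBV δ ∧ IsSymmetricOp δ ∧ PairingNondegenerate δ ∧ PairingPosDef δ) ∧
    (∀ δ : Forms n M →ₗ[ℝ] Forms n M, IsBV δ → IsSymmetricOp δ → PairingNondegenerate δ →
      (∃! g : Metric n M, IsInverseMetricOf δ g) ∧
      ∀ g : Metric n M, IsInverseMetricOf δ g → (g.PosDef ↔ PairingPosDef δ)) ∧
    (∀ g : Metric n M, (∃! δ : Forms n M →ₗ[ℝ] Forms n M, IsCodifferential g δ) ∧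
      ∀ δ : Forms n M →ₗ[ℝ] Forms n M, IsCodifferential g δ →
        IsBV δ ∧ IsSymmetricOp δ ∧ PairingNondegenerate δ ∧ IsInverseMetricOf δ g) := by
  have from_metric (g : Metric n M) (δ : Forms n M →ₗ[ℝ] Forms n M) (h : IsCodifferential g δ) :
      IsBV δ ∧ IsSymmetricOp δ ∧ PairingNondegenerate δ ∧ IsInverseMetricOf δ g :=
    ⟨h.isBV, h.isInverseMetricOf.isSymmetricOp h.isBV, h.isInverseMetricOf.pairingNondegenerate,
      h.isInverseMetricOf⟩
  refine ⟨⟨?_, ?_⟩, ⟨?_, ?_⟩, fun δ h hs hn => ⟨?_, fun g hg => hg.posDef_iff⟩,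
    fun g => ⟨⟨codiff g, isCodifferential_codiff g,
      fun δ h => h.unique (isCodifferential_codiff g)⟩, from_metric g⟩⟩
  · rintro ⟨g⟩
    obtain ⟨h, hs, hn, -⟩ := from_metric g _ (isCodifferential_codiff g)
    exact ⟨codiff g, h, hs, hn⟩
  · rintro ⟨δ, h, hs, hn⟩
    exact (h.exists_isInverseMetricOf hs hn).nonempty
  · rintro ⟨g, hg⟩
    obtain ⟨h, hs, hn, hi⟩ := from_metric g _ (isCodifferential_codiff g)
    exact ⟨codiff g, h, hs, hn, hi.posDef_iff.1 hg⟩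
  · rintro ⟨δ, h, hs, hn, hp⟩
    obtain ⟨g, hg⟩ := h.exists_isInverseMetricOf hs hn
    exact ⟨g, hg.posDef_iff.2 hp⟩
  · obtain ⟨g, hg⟩ := h.exists_isInverseMetricOf hs hn
    exact ⟨g, hg, fun g' hg' => hg'.unique hg⟩

open BVGeom in
theorem mainTheorem5 (n : ℕ) (M : Type*) [TopologicalSpace M]
    [ChartedSpace (EuclideanSpace ℝ (Fin n)) M] [IsManifold (𝓡 n) ∞ M]
    [T2Space M] [SecondCountableTopology M] :
    -- a metric exists iff a symmetric nondegenerate BV structure exists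
    (Nonempty (Metric n M) ↔
      ∃ δ : Forms n M →ₗ[ℝ] Forms n M, IsBV δ ∧ IsSymmetricOp δ ∧ PairingNondegenerate δ) ∧
    -- the same for positive definite metrics
    ((∃ g : Metric n M, g.PosDef) ↔
      ∃ δ : Forms n M →ₗ[ℝ] Forms n M,
        IsBV δ ∧ IsSymmetricOp δ ∧ PairingNondegenerate δ ∧ PairingPosDef δ) ∧
    -- the associated form of such a BV structure is the inverse of a unique metric
    (∀ δ : Forms n M →ₗ[ℝ] Forms n M, IsBV δ → IsSymmetricOp δ → PairingNondegenerate δ →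
      (∃! g : Metric n M, IsInverseMetricOf δ g) ∧
      ∀ g : Metric n M, IsInverseMetricOf δ g → (g.PosDef ↔ PairingPosDef δ)) ∧
    -- every metric arises so from its codifferential
    (∀ g : Metric n M, (∃! δ : Forms n M →ₗ[ℝ] Forms n M, IsCodifferential g δ) ∧
      ∀ δ : Forms n M →ₗ[ℝ] Forms n M, IsCodifferential g δ →
        IsBV δ ∧ IsSymmetricOp δ ∧ PairingNondegenerate δ ∧ IsInverseMetricOf δ g) :=
  mainTheorem5_general n M
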